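/- Let $\Omega\subset\mathbb{R}^2$ be a bounded polygonal domain (open, connected, with $\partial\Omega$ a finite union of segments) and let $\mathcal T_h$ be a conforming triangulation of $\Omega$: finitely many nondegenerate closed triangles with pairwise disjoint interiors, any two of which meet at most in a common vertex or a common edge, whose union is $\overline\Omega$, and such that $\partial\Omega$ is a union of edges of triangles. Edges contained in $\partial\Omega$ are called boundary edges, all others interior edges; an interior edge belongs to exactly two triangles. Let $k\ge 1$ and $$V_h=\{v\in L^2(\Omega): v|_T\in P_k(T)\ \ \forall T\in\mathcal T_h\},\qquad V_h^0=\{v\in V_h: v=0 \text{ on }\partial\Omega\},$$ where $v=0$ on $\partial\Omega$ means that the trace of $v|_T$ vanishes on $e$ for every triangle $T$ and every boundary edge $e$ of $T$. For $v\in V_h$ put $\{v\}=\frac12(v|_{T_1}+v|_{T_2})$ on an interior edge shared by $T_1$ and $T_2$; on a boundary edge of $T$ put $\{v\}=v|_T$. Let $RT_k(T)=[P_k(T)]^2+\mathbf{x}P_k(T)$, let $\mathbf n$ be the outward unit normal of $T$, and let the weak gradient $\nabla_w v\in RT_k(T)$ of $v\in V_h$ on $T$ be given by $$(\nabla_w v,\tau)_T=-(v,\nabla\cdot\tau)_T+\langle\{v\},\tau\cdot\mathbf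 n\rangle_{\partial T}\qquad\forall\,\tau\in RT_k(T).$$ Then: 1. For all $v\in V_h$ and $T\in\mathcal T_h$ this equation has exactly one solution $\nabla_w v\in RT_k(T)$. 2. The function $|||v|||=\bigl(\sum_{T\in\mathcal T_h}\|\nabla_w v\|_T^2\bigr)^{1/2}$ is a seminorm on $V_h$ and a norm on $V_h^0$. 3. The conforming DG scheme is well posed: for every $f\in L^2(\Omega)$ and every real function $g$ on $\partial\Omega$ there is exactly one $u_h\in V_h$ such that $u_h=I_hg$ on $\partial\Omega$ and $$\sum_{T\in\mathcal T_h}(\nabla_w u_h,\nabla_w v)_T=(f,v)\qquad\forall\, v\in V_h^0.$$ Here $I_hg$ is the $k$th order Lagrange interpolant of $g$: on each boundary edge it is the polynomial of degree at most $k$ that agrees with $g$ at the $k+1$ equidistant nodes of the edge, endpoints included. The condition $u_h=I_hg$ on $\partial\Omega$ means that the trace of $u_h|_T$ equals $I_hg$ on $e$ for every triangle $T$ and every boundary edge $e$ of $T$. -/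

import Mathlib

open MeasureTheory Set

noncomputable section

namespace CDG

/-- The Euclidean plane. -/
abbrev Plane : Type := EuclideanSpace ℝ (Fin 2)

/-- Real polynomials in two variables. -/
abbrev Poly : Type := MvPolynomial (Fin 2) ℝ

/-- The value of a polynomial at a point of the plane. -/
def ev (p : Poly) (x : Plane) : ℝ := MvPolynomial.eval (fun i => x i) p

/-- Polynomials of total degree at most `k`. -/
abbrev P (k : ℕ) : Submodule ℝ Poly := MvPolynomial.restrictTotalDegree (Fin 2) ℝ k

/-- A bounded polygonal domain: a bounded connected (in particular nonempty) open set whose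
boundary is a finite union of nondegenerate line segments. -/
structure IsPolygonalDomain (Ω : Set Plane) : Prop where
  isOpen : IsOpen Ω
  isConnected : IsConnected Ω
  isBounded : Bornology.IsBounded Ω
  frontier_eq : ∃ S : Set (Plane × Plane), S.Finite ∧ (∀ p ∈ S, p.1 ≠ p.2) ∧
    frontier Ω = ⋃ p ∈ S, segment ℝ p.1 p.2

/-- The edge of the triangle `T` opposite to its `m`-th vertex runs from `edgeA T m` … -/
def edgeA (T : Affine.Triangle ℝ Plane) (m : Fin 3) : Plane := T.points (m + 1)

/-- … to `edgeB T m`. -/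
def edgeB (T : Affine.Triangle ℝ Plane) (m : Fin 3) : Plane := T.points (m + 2)

/-- The closed edge of the triangle `T` opposite to its `m`-th vertex. -/
def edge (T : Affine.Triangle ℝ Plane) (m : Fin 3) : Set Plane :=
  segment ℝ (edgeA T m) (edgeB T m)

/-- The outward unit normal vector of `T` on its `m`-th edge: the direction from the opposite vertex
to the foot of the altitude on that edge, divided by the height. -/
def normal (T : Affine.Triangle ℝ Plane) (m : Fin 3) : Plane :=
  (T.height m)⁻¹ • (T.altitudeFoot m - T.points m)

/-- The line integral `∫_e φ ds` over the `m`-th edge of `T`. -/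
def edgeIntegral (T : Affine.Triangle ℝ Plane) (m : Fin 3) (φ : Plane → ℝ) : ℝ :=
  dist (edgeA T m) (edgeB T m) *
    ∫ t in (0 : ℝ)..1, φ (AffineMap.lineMap (edgeA T m) (edgeB T m) t)

/-- A (conforming) triangulation of `Ω`: finitely many nondegenerate closed triangles with pairwise
disjoint interiors, two of which meet at most in a common vertex or a common edge, whose union is
the closure of `Ω`, and such that the boundary of `Ω` is a union of edges of triangles. -/
structure Triangulation (Ω : Set Plane) where
  triangles : Finset (Affine.Triangle ℝ Plane)
  disjoint_interior : ∀ S ∈ triangles, ∀ T ∈ triangles, S ≠ T →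
    Disjoint (interior S.closedInterior) (interior T.closedInterior)
  conforming : ∀ S ∈ triangles, ∀ T ∈ triangles, S ≠ T →
    S.closedInterior ∩ T.closedInterior ⊆ convexHull ℝ (range S.points ∩ range T.points)
  cover : ⋃ T ∈ triangles, T.closedInterior = closure Ω
  frontier_edges : ∀ x ∈ frontier Ω, ∃ T ∈ triangles, ∃ m : Fin 3,
    x ∈ edge T m ∧ edge T m ⊆ frontier Ω

/-- `L²(Ω)`. -/
abbrev L2 (Ω : Set Plane) : Type := Lp ℝ 2 (volume.restrict Ω)

/-- `v|_T` is the polynomial `p`, of degree at most `k`. -/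
def IsRestr {Ω : Set Plane} (k : ℕ) (v : L2 Ω) (T : Affine.Triangle ℝ Plane) (p : Poly) : Prop :=
  p ∈ P k ∧ ∀ᵐ x ∂(volume.restrict Ω), x ∈ T.closedInterior → v x = ev p x

theorem IsRestr.zero {Ω : Set Plane} (k : ℕ) (T : Affine.Triangle ℝ Plane) :
    IsRestr k (0 : L2 Ω) T 0 := by
  refine ⟨Submodule.zero_mem _, ?_⟩
  filter_upwards [Lp.coeFn_zero ℝ 2 (volume.restrict Ω)] with x hx _
  rw [hx, ev, map_zero, Pi.zero_apply]

theorem IsRestr.add {Ω : Set Plane} {k : ℕ} {v w : L2 Ω} {T : Affine.Triangle ℝ Plane} {p q : Poly}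
    (hv : IsRestr k v T p) (hw : IsRestr k w T q) : IsRestr k (v + w) T (p + q) := by
  refine ⟨Submodule.add_mem _ hv.1 hw.1, ?_⟩
  filter_upwards [hv.2, hw.2, Lp.coeFn_add v w] with x h1 h2 h3 hx
  rw [h3, Pi.add_apply, h1 hx, h2 hx, ev, ev, ev, map_add]

theorem IsRestr.smul {Ω : Set Plane} {k : ℕ} {v : L2 Ω} {T : Affine.Triangle ℝ Plane} {p : Poly}
    (c : ℝ) (hv : IsRestr k v T p) : IsRestr k (c • v) T (c • p) := by
  refine ⟨Submodule.smul_mem _ c hv.1, ?_⟩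
  filter_upwards [hv.2, Lp.coeFn_smul c v] with x h1 h3 hx
  rw [h3, Pi.smul_apply, h1 hx, ev, ev, MvPolynomial.smul_eval, smul_eq_mul]

section Spaces

variable {Ω : Set Plane}

/-- The discontinuous finite element space
`V_h = {v ∈ L²(Ω) : v|_T ∈ P_k(T) for all triangles T}`. -/
def Vh (𝒯 : Triangulation Ω) (k : ℕ) : Submodule ℝ (L2 Ω) where
  carrier := {v | ∀ T : 𝒯.triangles, ∃ p, IsRestr k v T p}
  zero_mem' := fun T => ⟨0, IsRestr.zero k T⟩
  add_mem' := fun hv hw T =>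
    ⟨(hv T).choose + (hw T).choose, (hv T).choose_spec.add (hw T).choose_spec⟩
  smul_mem' := fun c _ hv T => ⟨c • (hv T).choose, (hv T).choose_spec.smul c⟩

/-- An edge of a triangle is a boundary edge if it lies on `∂Ω`. All other edges are interior. -/
def IsBoundaryEdge (Ω : Set Plane) (T : Affine.Triangle ℝ Plane) (m : Fin 3) : Prop :=
  edge T m ⊆ frontier Ω

/-- The space `V_h^0 = {v ∈ V_h : v = 0 on ∂Ω}`: the traces of `v` vanish on all boundary
edges. -/
def Vh0 (𝒯 : Triangulation Ω) (k : ℕ) : Submodule ℝ (Vh 𝒯 k) where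
  carrier := {v | ∀ T : 𝒯.triangles, ∃ p, IsRestr k (v : L2 Ω) T p ∧
    ∀ m, IsBoundaryEdge Ω T m → ∀ x ∈ edge T.1 m, ev p x = 0}
  zero_mem' := fun T => ⟨0, IsRestr.zero k T, by simp [ev]⟩
  add_mem' := by
    intro v w hv hw T
    obtain ⟨p, hp, hp0⟩ := hv T
    obtain ⟨q, hq, hq0⟩ := hw T
    refine ⟨p + q, hp.add hq, fun m hm x hx => ?_⟩
    have h1 := hp0 m hm x hx
    have h2 := hq0 m hm x hx
    simp only [ev] at h1 h2 ⊢
    rw [map_add, h1, h2, add_zero]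
  smul_mem' := by
    intro c v hv T
    obtain ⟨p, hp, hp0⟩ := hv T
    refine ⟨c • p, hp.smul c, fun m hm x hx => ?_⟩
    have h1 := hp0 m hm x hx
    simp only [ev] at h1 ⊢
    rw [MvPolynomial.smul_eval, h1, mul_zero]

variable {𝒯 : Triangulation Ω} {k : ℕ}

/-- The polynomial `v|_T` (unique, because `T` has positive area and is contained in `Ω` up to a
null set). -/
def restr (v : Vh 𝒯 k) (T : 𝒯.triangles) : Poly := (v.2 T).choose

open Classical in
/-- The average `{v}` on the `m`-th edge of `T`: on a boundary edge it is `v|_T`, on an interior edge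
it is half the sum of the `v|_{T'}` over the (exactly two) triangles `T'` that have this edge. -/
def avg (v : Vh 𝒯 k) (T : 𝒯.triangles) (m : Fin 3) : Poly :=
  if IsBoundaryEdge Ω T m then restr v T
  else (1 / 2 : ℝ) • ∑ T' : 𝒯.triangles,
    if edgeA T.1 m ∈ range T'.1.points ∧ edgeB T.1 m ∈ range T'.1.points then restr v T' else 0

end Spaces

/-- Vector fields on the plane with polynomial components. -/
abbrev VPoly : Type := Fin 2 → Poly

/-- The Raviart–Thomas space `RT_k = [P_k]² + x P_k`. -/
def RT (k : ℕ) : Submodule ℝ VPoly where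
  carrier := {τ | ∃ q : VPoly, ∃ p : Poly, (∀ i, q i ∈ P k) ∧ p ∈ P k ∧
    ∀ i, τ i = q i + MvPolynomial.X i * p}
  zero_mem' := ⟨0, 0, fun _ => Submodule.zero_mem _, Submodule.zero_mem _, by simp⟩
  add_mem' := by
    rintro σ τ ⟨q, p, hq, hp, h⟩ ⟨q', p', hq', hp', h'⟩
    refine ⟨q + q', p + p', fun i => Submodule.add_mem _ (hq i) (hq' i),
      Submodule.add_mem _ hp hp', fun i => ?_⟩
    rw [Pi.add_apply, h, h', Pi.add_apply]
    ring
  smul_mem' := by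
    rintro c τ ⟨q, p, hq, hp, h⟩
    refine ⟨c • q, c • p, fun i => Submodule.smul_mem _ c (hq i), Submodule.smul_mem _ c hp,
      fun i => ?_⟩
    rw [Pi.smul_apply, h, Pi.smul_apply, smul_add, mul_smul_comm]

/-- The divergence `∇·τ`. -/
def divergence (τ : VPoly) : Poly := ∑ i, MvPolynomial.pderiv i (τ i)

/-- `(σ, τ)_T = ∫_T σ · τ dx`. -/
def innerT (T : Affine.Triangle ℝ Plane) (σ τ : VPoly) : ℝ :=
  ∫ x in T.closedInterior, ∑ i, ev (σ i) x * ev (τ i) x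

section Scheme

variable {Ω : Set Plane} {𝒯 : Triangulation Ω} {k : ℕ}

/-- The defining property of the weak gradient of `v` on `T`: `g ∈ RT_k` and
`(g, τ)_T = -(v, ∇·τ)_T + ⟨{v}, τ·n⟩_{∂T}` for all `τ ∈ RT_k`. -/
def IsWeakGradient (v : Vh 𝒯 k) (T : 𝒯.triangles) (g : VPoly) : Prop :=
  g ∈ RT k ∧ ∀ τ ∈ RT k, innerT T g τ =
    -(∫ x in T.1.closedInterior, ev (restr v T) x * ev (divergence τ) x) +
      ∑ m : Fin 3, edgeIntegral T m
        (fun x => ev (avg v T m) x * ∑ i, ev (τ i) x * normal T.1 m i)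

open Classical in
/-- The weak gradient `∇_w v` on `T` (the default value is never used: the theorem asserts that
there is exactly one weak gradient). -/
def weakGrad (v : Vh 𝒯 k) (T : 𝒯.triangles) : VPoly :=
  if h : ∃ g, IsWeakGradient v T g then h.choose else 0

/-- `(∇_w u, ∇_w v)_{𝒯_h} = ∑_T (∇_w u, ∇_w v)_T`. -/
def weakForm (u v : Vh 𝒯 k) : ℝ := ∑ T : 𝒯.triangles, innerT T (weakGrad u T) (weakGrad v T)

/-- The triple-bar seminorm, `|||v|||² = ∑_T (∇_w v, ∇_w v)_T`. -/
def tripleNorm (v : Vh 𝒯 k) : ℝ := Real.sqrt (weakForm v v)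

/-- The `k`-th order Lagrange interpolant of `g` on the `m`-th edge of `T`, at the `k + 1`
equidistant nodes `a + (j/k)(b - a)`, as a polynomial in the edge parameter `t ∈ [0, 1]`. -/
def edgeInterp (k : ℕ) (g : Plane → ℝ) (T : Affine.Triangle ℝ Plane) (m : Fin 3) :
    Polynomial ℝ :=
  Lagrange.interpolate (Finset.range (k + 1)) (fun j : ℕ => (j : ℝ) / (k : ℝ))
    (fun j : ℕ => g (AffineMap.lineMap (edgeA T m) (edgeB T m) ((j : ℝ) / (k : ℝ))))

/-- `u = I_h g` on `∂Ω`. -/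
def EqInterpOnBoundary (u : Vh 𝒯 k) (g : Plane → ℝ) : Prop :=
  ∀ (T : 𝒯.triangles) (m : Fin 3), IsBoundaryEdge Ω T m → ∀ t ∈ Icc (0 : ℝ) 1,
    ev (restr u T) (AffineMap.lineMap (edgeA T.1 m) (edgeB T.1 m) t) = (edgeInterp k g T m).eval t

/-- `u` solves the conforming DG scheme with right-hand side `f` and boundary data `g`. -/
def IsSolution (f : L2 Ω) (g : Plane → ℝ) (u : Vh 𝒯 k) : Prop :=
  EqInterpOnBoundary u g ∧
    ∀ v ∈ Vh0 𝒯 k, weakForm u v = ∫ x in Ω, f x * (v : L2 Ω) x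

end Scheme

end CDG

end

/-! Put B(u, v) = ∑_T (∇_w u, ∇_w v)_T. The weak gradient is a Riesz representative for the L² inner
product on the finite-dimensional space RT_k(T) (`exists_bilinForm_eq`). Uniqueness makes it linear
in v, so B is symmetric and positive semidefinite. What remains is definiteness on V_h^0 and a
lifting of the boundary data.

Definiteness: if B(v, v) = 0, all weak gradients vanish, and integration by parts gives (∇v, τ)_T =
⟨v - {v}, τ·n⟩_{∂T} for all τ in RT_k(T). With vertices x_m and barycentric coordinates λ_m, the
field τ = -∑ λ_m (x_m·∇v)(x - x_m) lies in RT_k(T), has zero normal trace, and satisfies ∇v·τ = ∑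
λ_m ((x_m - x)·∇v)²; this is the variance formula for the weights λ_m, whose mean is x. Hence ∇v = 0
on T, and the fields (x - x_m)(v - {v}) then force v = {v} on every edge
(`grad_eq_zero_of_forall_innerT_eq`).

So v is piecewise constant, equals its average on interior edges, and is zero on triangles with a
boundary edge. If it took a value c ≠ 0, the union K of the triangles carrying c would continue
across each of its edges, so its frontier would consist of vertices only. A compact plane set with
nonempty interior has no finite frontier, because finite sets do not disconnect the plane
(`eq_zero_of_eq_average`).

Lifting: the interpolants on the three edges of a triangle agree at the vertices, so they are the
trace of one polynomial of degree k (`exists_poly_eq_on_edges`), and V_h asks for no continuity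
between triangles. Subtracting the lifting leaves a problem on V_h^0, solved by Riesz representation
for B. -/

noncomputable section

namespace CDG

/-! ### Polynomials as functions on the plane. -/

section Evaluation

@[simp] theorem ev_zero (x : Plane) : ev 0 x = 0 := by simp [ev]
@[simp] theorem ev_one (x : Plane) : ev 1 x = 1 := by simp [ev]
@[simp] theorem ev_add (p q : Poly) (x : Plane) : ev (p + q) x = ev p x + ev q x := by simp [ev]
@[simp] theorem ev_sub (p q : Poly) (x : Plane) : ev (p - q) x = ev p x - ev q x := by simp [ev]
@[simp] theorem ev_neg (p : Poly) (x : Plane) : ev (-p) x = -ev p x := by simp [ev]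
@[simp] theorem ev_mul (p q : Poly) (x : Plane) : ev (p * q) x = ev p x * ev q x := by simp [ev]
@[simp] theorem ev_smul (c : ℝ) (p : Poly) (x : Plane) : ev (c • p) x = c * ev p x := by simp [ev]
@[simp] theorem ev_C (c : ℝ) (x : Plane) : ev (MvPolynomial.C c) x = c := by simp [ev]
@[simp] theorem ev_X (i : Fin 2) (x : Plane) : ev (MvPolynomial.X i) x = x i := by simp [ev]
@[simp] theorem ev_sum {ι : Type*} (s : Finset ι) (p : ι → Poly) (x : Plane) :
    ev (∑ i ∈ s, p i) x = ∑ i ∈ s, ev (p i) x := by simp [ev]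

theorem continuous_ev (p : Poly) : Continuous (ev p) := by
  unfold ev
  have h := MvPolynomial.continuous_eval p
  exact h.comp (by fun_prop)

/-- A polynomial that vanishes on a nonempty open set is zero. -/
theorem eq_zero_of_ev_eq_zero_on_open {p : Poly} {U : Set Plane} (hU : IsOpen U)
    (hne : U.Nonempty) (h : ∀ x ∈ U, ev p x = 0) : p = 0 := by
  obtain ⟨x, hx⟩ := hne
  -- Balls of the sup metric on `Fin 2 → ℝ` are boxes, so U contains a product of two infinite sets,
  -- on which only the zero polynomial vanishes.
  have hV : IsOpen ((fun y : Fin 2 → ℝ => (WithLp.toLp 2 y : Plane)) ⁻¹' U) :=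
    hU.preimage (by fun_prop)
  have hx' : (fun i => x i) ∈ ((fun y : Fin 2 → ℝ => (WithLp.toLp 2 y : Plane)) ⁻¹' U) := hx
  obtain ⟨ε, hε, hball⟩ := Metric.isOpen_iff.1 hV _ hx'
  refine MvPolynomial.funext_set (fun i => Metric.ball (x i) ε) (fun i => ?_) ?_
  · rw [Real.ball_eq_Ioo]
    exact Ioo_infinite (by linarith)
  · intro y hy
    rw [map_zero]
    exact h _ (hball (by rw [ball_pi _ hε]; exact hy))

end Evaluation

/-! ### Barycentric coordinates of a triangle. -/

section Barycentric

variable (T : Affine.Triangle ℝ Plane)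

/-- The cross product of two plane vectors. -/
def cross (u v : Plane) : ℝ := u 0 * v 1 - u 1 * v 0

/-- Twice the signed area of a triangle. -/
def area2 : ℝ := cross (T.points 1 - T.points 0) (T.points 2 - T.points 0)

theorem cross_eq_area2 (m : Fin 3) :
    cross (T.points (m + 1) - T.points m) (T.points (m + 2) - T.points m) = area2 T := by
  fin_cases m <;> simp [area2, cross] <;> ring

theorem area2_ne_zero : area2 T ≠ 0 := by
  intro h0
  have hli := (affineIndependent_iff_linearIndependent_vsub ℝ T.points 0).1 T.independent
  have h12 : LinearIndependent ℝ ![T.points 1 - T.points 0, T.points 2 - T.points 0] := by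
    have := hli.comp (![⟨1, by decide⟩, ⟨2, by decide⟩] : Fin 2 → {x : Fin 3 // x ≠ 0})
      (by intro i j; fin_cases i <;> fin_cases j <;> simp)
    rwa [show (fun i : {x : Fin 3 // x ≠ 0} => T.points i -ᵥ T.points 0) ∘
      (![⟨1, by decide⟩, ⟨2, by decide⟩] : Fin 2 → {x : Fin 3 // x ≠ 0}) =
        ![T.points 1 - T.points 0, T.points 2 - T.points 0] by
      ext i : 1
      fin_cases i <;> rfl] at this
  rw [LinearIndependent.pair_iff] at h12
  set a := T.points 1 - T.points 0 with ha
  set b := T.points 2 - T.points 0 with hb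
  have hD : a 0 * b 1 - a 1 * b 0 = 0 := h0
  -- A zero determinant gives the relations b₀a - a₀b = 0 and b₁a - a₁b = 0. Independence then
  -- yields a₀ = a₁ = 0, so a = 0, which contradicts independence.
  have e1 := h12 (b 0) (-(a 0)) (by
    ext i; fin_cases i <;> simp <;> linarith)
  have e2 := h12 (b 1) (-(a 1)) (by
    ext i; fin_cases i <;> simp <;> linarith)
  have e3 := h12 1 0 (by
    ext i; fin_cases i <;> simp <;> [linarith [e1.2]; linarith [e2.2]])
  exact one_ne_zero e3.1

/-- The barycentric coordinate of `T` that belongs to the `m`-th vertex. -/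
def bary (m : Fin 3) : Poly :=
  MvPolynomial.C ((area2 T)⁻¹) *
    (MvPolynomial.C (T.points (m + 2) 0 - T.points (m + 1) 0) *
        (MvPolynomial.X 1 - MvPolynomial.C (T.points (m + 1) 1)) -
      MvPolynomial.C (T.points (m + 2) 1 - T.points (m + 1) 1) *
        (MvPolynomial.X 0 - MvPolynomial.C (T.points (m + 1) 0)))

theorem ev_bary (m : Fin 3) (x : Plane) : ev (bary T m) x =
    (area2 T)⁻¹ * cross (T.points (m + 2) - T.points (m + 1)) (x - T.points (m + 1)) := by
  simp [bary, cross]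

@[simp] theorem ev_bary_self (m : Fin 3) : ev (bary T m) (T.points m) = 1 := by
  rw [ev_bary, inv_mul_eq_one₀ (area2_ne_zero T), ← cross_eq_area2 T m]
  simp [cross]; ring

@[simp] theorem ev_bary_add_one (m : Fin 3) : ev (bary T m) (T.points (m + 1)) = 0 := by
  simp [ev_bary, cross]

@[simp] theorem ev_bary_add_two (m : Fin 3) : ev (bary T m) (T.points (m + 2)) = 0 := by
  rw [ev_bary]; simp [cross]; right; ring

theorem add_one_add_one (m : Fin 3) : m + 1 + 1 = m + 2 := by fin_cases m <;> rfl
theorem add_one_add_two (m : Fin 3) : m + 1 + 2 = m := by fin_cases m <;> rfl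
theorem add_two_add_one (m : Fin 3) : m + 2 + 1 = m := by fin_cases m <;> rfl
theorem add_two_add_two (m : Fin 3) : m + 2 + 2 = m + 1 := by fin_cases m <;> rfl

theorem eq_or_eq_or_eq (m j : Fin 3) : j = m ∨ j = m + 1 ∨ j = m + 2 := by
  revert m j; decide

theorem sum_fin_three {M : Type*} [AddCommMonoid M] (m : Fin 3) (f : Fin 3 → M) :
    ∑ j, f j = f m + f (m + 1) + f (m + 2) := by
  rw [Fin.sum_univ_three]
  fin_cases m
  · rfl
  · change f 0 + f 1 + f 2 = f 1 + f 2 + f 0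
    abel
  · change f 0 + f 1 + f 2 = f 2 + f 0 + f 1
    abel

@[simp] theorem ev_bary_add_one' (m : Fin 3) : ev (bary T (m + 1)) (T.points m) = 0 := by
  have := ev_bary_add_two T (m + 1)
  rwa [add_one_add_two] at this

@[simp] theorem ev_bary_add_two' (m : Fin 3) : ev (bary T (m + 2)) (T.points m) = 0 := by
  have := ev_bary_add_one T (m + 2)
  rwa [add_two_add_one] at this

theorem ev_bary_vertex (m j : Fin 3) : ev (bary T m) (T.points j) = if m = j then 1 else 0 := by
  rcases eq_or_eq_or_eq m j with rfl | rfl | rfl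
  · simp
  · rw [ev_bary_add_one, if_neg]; revert m; decide
  · rw [ev_bary_add_two, if_neg]; revert m; decide

theorem sum_ev_bary (x : Plane) : ∑ m, ev (bary T m) x = 1 := by
  have h : ∀ m, ev (bary T m) x = (area2 T)⁻¹ *
    cross (T.points (m + 2) - T.points (m + 1)) (x - T.points (m + 1)) := fun m => ev_bary T m x
  simp only [h, ← Finset.mul_sum]
  rw [inv_mul_eq_one₀ (area2_ne_zero T), Fin.sum_univ_three]
  simp [cross, area2]; ring

theorem sum_ev_bary_smul (x : Plane) : ∑ m, ev (bary T m) x • T.points m = x := by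
  have h : ∀ m, ev (bary T m) x = (area2 T)⁻¹ *
    cross (T.points (m + 2) - T.points (m + 1)) (x - T.points (m + 1)) := fun m => ev_bary T m x
  simp only [h, mul_smul, ← Finset.smul_sum]
  rw [inv_smul_eq_iff₀ (area2_ne_zero T), Fin.sum_univ_three]
  ext i
  fin_cases i <;> simp [cross, area2] <;> ring

theorem ev_bary_lineMap (m : Fin 3) (a b : Plane) (t : ℝ) :
    ev (bary T m) (AffineMap.lineMap a b t) =
      (1 - t) * ev (bary T m) a + t * ev (bary T m) b := by
  simp only [ev_bary, cross, AffineMap.lineMap_apply]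
  simp
  ring

theorem ev_bary_sum (m : Fin 3) (w : Fin 3 → ℝ) (hw : ∑ i, w i = 1) :
    ev (bary T m) (∑ i, w i • T.points i) = w m := by
  have h1 : ev (bary T m) (∑ i, w i • T.points i) = ∑ i, w i * ev (bary T m) (T.points i) := by
    rw [Fin.sum_univ_three] at hw
    have h0 : w 0 = 1 - w 1 - w 2 := by linarith
    simp only [ev_bary, cross, Fin.sum_univ_three, h0]
    simp
    ring
  rw [h1, sum_fin_three m]
  simp

theorem mem_closedInterior_iff (x : Plane) :
    x ∈ T.closedInterior ↔ ∀ m, 0 ≤ ev (bary T m) x := by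
  constructor
  · rintro ⟨w, hw, hw01, rfl⟩ m
    rw [Finset.affineCombination_eq_linear_combination _ _ _ hw, ev_bary_sum T m w hw]
    exact (hw01 m).1
  · intro h
    have hs := sum_ev_bary T x
    refine ⟨fun m => ev (bary T m) x, hs, fun m => ⟨h m, ?_⟩, ?_⟩
    · rw [← hs]
      exact Finset.single_le_sum (fun i _ => h i) (Finset.mem_univ m)
    · rw [Finset.affineCombination_eq_linear_combination _ _ _ hs, sum_ev_bary_smul]

theorem isOpen_bary_pos : IsOpen {x | ∀ m, 0 < ev (bary T m) x} := by
  simp only [ofPred_forall]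
  exact isOpen_iInter_of_finite fun m => isOpen_lt continuous_const (continuous_ev _)

theorem bary_pos_subset_interior :
    {x | ∀ m, 0 < ev (bary T m) x} ⊆ interior T.closedInterior :=
  interior_maximal (fun x hx => (mem_closedInterior_iff T x).2 fun m => (hx m).le)
    (isOpen_bary_pos T)

theorem nonempty_bary_pos : {x | ∀ m, 0 < ev (bary T m) x}.Nonempty := by
  refine ⟨∑ i, (1 / 3 : ℝ) • T.points i, fun m => ?_⟩
  rw [ev_bary_sum T m (fun _ => 1 / 3) (by simp)]
  norm_num

theorem nonempty_interior : (interior T.closedInterior).Nonempty :=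
  (nonempty_bary_pos T).mono (bary_pos_subset_interior T)

theorem isCompact_closedInterior : IsCompact T.closedInterior :=
  Affine.Simplex.isCompact_closedInterior T

theorem measurableSet_closedInterior : MeasurableSet T.closedInterior :=
  (isCompact_closedInterior T).isClosed.measurableSet

theorem convex_closedInterior : Convex ℝ T.closedInterior := by
  rw [← Affine.Simplex.convexHull_eq_closedInterior]
  exact convex_convexHull _ _

theorem lineMap_mem_edge (m : Fin 3) {t : ℝ} (ht : t ∈ Icc (0 : ℝ) 1) :
    AffineMap.lineMap (edgeA T m) (edgeB T m) t ∈ edge T m := by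
  rw [edge, segment_eq_image_lineMap]
  exact ⟨t, ht, rfl⟩

end Barycentric

/-! ### Integrals over a triangle by Fubini. -/

section Integration

variable (T : Affine.Triangle ℝ Plane)

/-- The affine parametrisation of the plane with origin at the `m`-th vertex of `T` and the two
edges at that vertex as basis vectors. -/
def param (m : Fin 3) (s t : ℝ) : Plane :=
  T.points m + s • (T.points (m + 1) - T.points m) + t • (T.points (m + 2) - T.points m)

theorem ev_bary_param (m j : Fin 3) (s t : ℝ) : ev (bary T j) (param T m s t) =
    (1 - s - t) * ev (bary T j) (T.points m) + s * ev (bary T j) (T.points (m + 1)) +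
      t * ev (bary T j) (T.points (m + 2)) := by
  simp only [ev_bary, cross, param]
  simp
  ring

theorem continuous_param (m : Fin 3) : Continuous fun z : ℝ × ℝ => param T m z.1 z.2 := by
  unfold param; fun_prop

theorem param_mem_iff (m : Fin 3) (s t : ℝ) :
    param T m s t ∈ T.closedInterior ↔ 0 ≤ s ∧ 0 ≤ t ∧ s + t ≤ 1 := by
  rw [mem_closedInterior_iff]
  have h0 := ev_bary_param T m m s t
  have h1 := ev_bary_param T m (m + 1) s t
  have h2 := ev_bary_param T m (m + 2) s t
  have e1 : ev (bary T (m + 1)) (T.points (m + 2)) = 0 := by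
    have := ev_bary_add_one T (m + 1); rwa [add_one_add_one] at this
  have e2 : ev (bary T (m + 2)) (T.points (m + 1)) = 0 := by
    have := ev_bary_add_two T (m + 2); rwa [add_two_add_two] at this
  simp only [ev_bary_self, ev_bary_add_one, ev_bary_add_two, ev_bary_add_one', ev_bary_add_two',
    e1, e2, mul_one, mul_zero, add_zero, zero_add] at h0 h1 h2
  constructor
  · intro h
    exact ⟨h1 ▸ h _, h2 ▸ h _, by linarith [h0 ▸ h m]⟩
  · rintro ⟨hs, ht, hst⟩ j
    rcases eq_or_eq_or_eq m j with rfl | rfl | rfl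
    · rw [h0]; linarith
    · rwa [h1]
    · rwa [h2]

theorem exists_param (m : Fin 3) (x : Plane) : ∃ s t, param T m s t = x := by
  have h1 := sum_ev_bary T x
  have h2 := sum_ev_bary_smul T x
  rw [sum_fin_three m] at h1 h2
  refine ⟨ev (bary T (m + 1)) x, ev (bary T (m + 2)) x, ?_⟩
  conv_rhs => rw [← h2, show ev (bary T m) x =
    1 - ev (bary T (m + 1)) x - ev (bary T (m + 2)) x by linarith]
  unfold param
  module

/-- Coordinates identify the Euclidean plane with `ℝ × ℝ`. -/
def toProd : Plane ≃ᵐ ℝ × ℝ :=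
  (MeasurableEquiv.toLp 2 (Fin 2 → ℝ)).symm.trans MeasurableEquiv.finTwoArrow

theorem toProd_apply (x : Plane) : toProd x = (x 0, x 1) := rfl

theorem measurePreserving_toProd : MeasurePreserving toProd :=
  (volume_preserving_finTwoArrow ℝ).comp
    (EuclideanSpace.volume_preserving_symm_measurableEquiv_toLp (Fin 2))

/-- The linear part of `param` in coordinates. -/
def paramLin (m : Fin 3) : ℝ × ℝ →L[ℝ] ℝ × ℝ :=
  (Matrix.toLin (Module.Basis.finTwoProd ℝ) (Module.Basis.finTwoProd ℝ)
    !![T.points (m + 1) 0 - T.points m 0, T.points (m + 2) 0 - T.points m 0;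
      T.points (m + 1) 1 - T.points m 1, T.points (m + 2) 1 - T.points m 1]).toContinuousLinearMap

theorem det_paramLin (m : Fin 3) : (paramLin T m).det = area2 T := by
  rw [paramLin, LinearMap.det_toContinuousLinearMap, LinearMap.det_toLin, Matrix.det_fin_two,
    ← cross_eq_area2 T m]
  simp [cross]
  ring

theorem toProd_param (m : Fin 3) (z : ℝ × ℝ) :
    toProd (param T m z.1 z.2) = toProd (T.points m) + paramLin T m z := by
  simp only [toProd_apply, paramLin, param, LinearMap.coe_toContinuousLinearMap',
    Matrix.toLin_finTwoProd_apply]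
  ext <;> simp <;> ring

theorem integrableOn_closedInterior {φ : Plane → ℝ} (hφ : Continuous φ) :
    IntegrableOn φ T.closedInterior :=
  hφ.continuousOn.integrableOn_compact (isCompact_closedInterior T)

/-- Affine change of variables from the reference triangle, with Jacobian `area2 T`, followed by
Fubini. The inner integral runs parallel to the edge from vertex m to vertex m + 1, ready for the
fundamental theorem of calculus in that direction. -/
theorem setIntegral_closedInterior (m : Fin 3) {φ : Plane → ℝ} (hφ : Continuous φ) :
    ∫ x in T.closedInterior, φ x =
      |area2 T| * ∫ t in (0 : ℝ)..1, ∫ s in (0 : ℝ)..(1 - t), φ (param T m s t) := by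
  set S : Set (ℝ × ℝ) := {z | 0 ≤ z.1 ∧ 0 ≤ z.2 ∧ z.1 + z.2 ≤ 1} with hS
  set Φ : ℝ × ℝ → ℝ × ℝ := fun z => toProd (T.points m) + paramLin T m z with hΦ
  have hSc : IsClosed S :=
    (isClosed_le continuous_const continuous_fst).inter
      ((isClosed_le continuous_const continuous_snd).inter
        (isClosed_le (continuous_fst.add continuous_snd) continuous_const))
  have hSm : MeasurableSet S := hSc.measurableSet
  have hSk : IsCompact S := by
    refine (isCompact_Icc (a := ((0 : ℝ), (0 : ℝ))) (b := ((1 : ℝ), (1 : ℝ)))).of_isClosed_subset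
      hSc ?_
    rintro ⟨a, b⟩ ⟨h1, h2, h3⟩
    simp only at h1 h2 h3
    exact ⟨⟨h1, h2⟩, ⟨by simp only; linarith, by simp only; linarith⟩⟩
  have himg : T.closedInterior = toProd ⁻¹' (Φ '' S) := by
    ext x
    obtain ⟨s, t, rfl⟩ := exists_param T m x
    rw [param_mem_iff, mem_preimage]
    constructor
    · intro h
      exact ⟨(s, t), h, (toProd_param T m (s, t)).symm⟩
    · rintro ⟨z, hz, hzx⟩
      have hz' : param T m z.1 z.2 = param T m s t := by
        apply toProd.injective
        rw [toProd_param]; exact hzx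
      rw [← param_mem_iff T m, ← hz', param_mem_iff]
      exact hz
  have hinj : Function.Injective Φ := by
    intro z w hzw
    have h : param T m z.1 z.2 = param T m w.1 w.2 := by
      apply toProd.injective
      rw [toProd_param, toProd_param]; exact hzw
    have e1 : ev (bary T (m + 1)) (T.points (m + 2)) = 0 := by
      have := ev_bary_add_one T (m + 1); rwa [add_one_add_one] at this
    have e2 : ev (bary T (m + 2)) (T.points (m + 1)) = 0 := by
      have := ev_bary_add_two T (m + 2); rwa [add_two_add_two] at this
    have h1 := congrArg (ev (bary T (m + 1))) h
    have h2 := congrArg (ev (bary T (m + 2))) h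
    simp only [ev_bary_param, ev_bary_self, ev_bary_add_one', ev_bary_add_two',
      e1, e2, mul_one, mul_zero, add_zero, zero_add] at h1 h2
    exact Prod.ext h1 h2
  have hstep1 : ∫ x in T.closedInterior, φ x = ∫ y in Φ '' S, φ (toProd.symm y) := by
    rw [himg, ← measurePreserving_toProd.setIntegral_preimage_emb toProd.measurableEmbedding]
    simp
  have hstep2 : ∫ y in Φ '' S, φ (toProd.symm y) =
      |area2 T| * ∫ z in S, φ (param T m z.1 z.2) := by
    rw [integral_image_eq_integral_abs_det_fderiv_smul volume hSm
      (f' := fun _ => paramLin T m)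
      (fun z _ => (((paramLin T m).hasFDerivAt).const_add _).hasFDerivWithinAt) hinj.injOn]
    simp only [det_paramLin, smul_eq_mul]
    rw [integral_const_mul]
    congr 2
    ext z
    rw [← toProd_param, MeasurableEquiv.symm_apply_apply]
  have hcont : Continuous fun z : ℝ × ℝ => φ (param T m z.1 z.2) := hφ.comp (continuous_param T m)
  rw [hstep1, hstep2, ← integral_indicator hSm]
  congr 1
  rw [Measure.volume_eq_prod, integral_prod_symm]
  · rw [intervalIntegral.integral_of_le zero_le_one, ← integral_Icc_eq_integral_Ioc,
      ← integral_indicator measurableSet_Icc]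
    congr 1
    ext t
    by_cases ht : t ∈ Icc (0 : ℝ) 1
    · rw [indicator_of_mem ht, intervalIntegral.integral_of_le (by linarith [ht.2]),
        ← integral_Icc_eq_integral_Ioc, ← integral_indicator measurableSet_Icc]
      congr 1
      ext s
      by_cases hs : s ∈ Icc (0 : ℝ) (1 - t)
      · rw [indicator_of_mem hs, indicator_of_mem]
        exact ⟨hs.1, ht.1, by simp only; linarith [hs.2]⟩
      · rw [indicator_of_notMem hs, indicator_of_notMem]
        rintro ⟨h1, h2, h3⟩
        simp only at h1 h2 h3
        exact hs ⟨h1, by linarith⟩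
    · rw [indicator_of_notMem ht]
      refine integral_eq_zero_of_ae (Filter.Eventually.of_forall fun s => ?_)
      refine indicator_of_notMem ?_ _
      rintro ⟨h1, h2, h3⟩
      simp only at h1 h2 h3
      exact ht ⟨h2, by linarith⟩
  · rw [integrable_indicator_iff hSm, ← Measure.volume_eq_prod]
    exact hcont.continuousOn.integrableOn_compact hSk

theorem hasDerivAt_ev (f : Poly) (x d : Plane) (s : ℝ) :
    HasDerivAt (fun s : ℝ => ev f (x + s • d))
      (∑ i, d i * ev (MvPolynomial.pderiv i f) (x + s • d)) s := by
  induction f using MvPolynomial.induction_on with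
  | C a => simpa using hasDerivAt_const s a
  | add p q hp hq =>
    simp only [map_add, ev_add, mul_add, Finset.sum_add_distrib]
    exact hp.add hq
  | mul_X p j hp =>
    have hX : HasDerivAt (fun s : ℝ => ev (MvPolynomial.X j) (x + s • d)) (d j) s := by
      simp only [ev_X, PiLp.add_apply, PiLp.smul_apply, smul_eq_mul]
      simpa using ((hasDerivAt_id s).mul_const (d j)).const_add (x j)
    have h := hp.mul hX
    simp only [ev_mul]
    convert! h using 1
    simp only [Derivation.leibniz, smul_eq_mul, ev_add, ev_mul, mul_add, Finset.sum_add_distrib,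
      Fin.sum_univ_two]
    fin_cases j <;> simp [MvPolynomial.pderiv_X] <;> ring

/-- Each segment parallel to the edge from vertex m to vertex m + 1 starts on the edge opposite m +
1 and ends on the edge opposite m, so the fundamental theorem leaves the difference of the two edge
integrals. -/
theorem setIntegral_directional (m : Fin 3) (f : Poly) :
    ∫ x in T.closedInterior,
        ∑ i, (T.points (m + 1) - T.points m) i * ev (MvPolynomial.pderiv i f) x =
      |area2 T| * ((∫ t in (0 : ℝ)..1, ev f (AffineMap.lineMap (edgeA T m) (edgeB T m) t)) -
        ∫ t in (0 : ℝ)..1,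
          ev f (AffineMap.lineMap (edgeA T (m + 1)) (edgeB T (m + 1)) t)) := by
  have hl : ∀ a b : Plane, Continuous fun t : ℝ => ev f (AffineMap.lineMap a b t) := fun a b =>
    (continuous_ev f).comp (AffineMap.lineMap_continuous)
  have hl' : ∀ a b : Plane, Continuous fun t : ℝ => ev f (AffineMap.lineMap a b (1 - t)) :=
    fun a b => (hl a b).comp (by fun_prop)
  have hc : Continuous fun x : Plane =>
      ∑ i, (T.points (m + 1) - T.points m) i * ev (MvPolynomial.pderiv i f) x :=
    continuous_finsetSum _ fun i _ => continuous_const.mul (continuous_ev _)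
  rw [setIntegral_closedInterior T m hc]
  congr 1
  -- Edge m + 1 runs from vertex m + 2 to vertex m, against the direction of t.
  have hrev := intervalIntegral.integral_comp_sub_left (a := 0) (b := 1)
    (fun t : ℝ => ev f (AffineMap.lineMap (edgeA T (m + 1)) (edgeB T (m + 1)) t)) 1
  rw [sub_self, sub_zero] at hrev
  rw [← hrev, ← intervalIntegral.integral_sub ((hl _ _).intervalIntegrable _ _)
    ((hl' _ _).intervalIntegrable _ _)]
  congr 1
  ext t
  have hd := hasDerivAt_ev f (T.points m + t • (T.points (m + 2) - T.points m))
    (T.points (m + 1) - T.points m)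
  have hp : ∀ s, param T m s t = T.points m + t • (T.points (m + 2) - T.points m) +
      s • (T.points (m + 1) - T.points m) := fun s => by unfold param; abel
  simp only [hp]
  rw [intervalIntegral.integral_eq_sub_of_hasDerivAt (fun s _ => hd s)]
  · congr 2
    · rw [AffineMap.lineMap_apply_module, edgeA, edgeB]; module
    · rw [AffineMap.lineMap_apply_module, edgeA, edgeB, add_one_add_one, add_one_add_two]; module
  · refine Continuous.intervalIntegrable (continuous_finsetSum _ fun i _ =>
      continuous_const.mul ((continuous_ev _).comp (by fun_prop))) _ _

end Integration

/-! ### Normals, the divergence theorem and integration by parts. -/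

section Normal

variable (T : Affine.Triangle ℝ Plane)

theorem sum_mul_normal {m j : Fin 3} (h : m ≠ j) :
    ∑ i, (T.points j - T.points m) i * normal T m i = T.height m := by
  have h1 := T.inner_vsub_vsub_altitudeFoot_eq_height_sq h
  have h0 := T.height_pos m
  rw [EuclideanSpace.inner_eq_star_dotProduct] at h1
  simp only [dotProduct, Fin.sum_univ_two, vsub_eq_sub, WithLp.ofLp_sub, Pi.sub_apply,
    Pi.star_apply, star_trivial, normal, PiLp.smul_apply, PiLp.sub_apply, smul_eq_mul] at h1 ⊢
  field_simp
  linarith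

theorem sum_normal_sq (m : Fin 3) : normal T m 0 ^ 2 + normal T m 1 ^ 2 = 1 := by
  have h0 := T.height_pos m
  have h1 : ‖T.altitudeFoot m - T.points m‖ ^ 2 = T.height m ^ 2 := by
    rw [Affine.Simplex.height, dist_comm, dist_eq_norm]
  rw [EuclideanSpace.norm_sq_eq, Fin.sum_univ_two] at h1
  simp only [Real.norm_eq_abs, sq_abs, PiLp.sub_apply] at h1
  simp only [normal, PiLp.smul_apply, PiLp.sub_apply, smul_eq_mul]
  field_simp
  linarith

/-- Base times height is twice the area. -/
theorem dist_mul_height (m : Fin 3) : dist (edgeA T m) (edgeB T m) * T.height m = |area2 T| := by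
  have hm1 : m ≠ m + 1 := by revert m; decide
  have hm2 : m ≠ m + 2 := by revert m; decide
  have h1 := sum_mul_normal T hm1
  have h2 := sum_mul_normal T hm2
  have h3 := sum_normal_sq T m
  have h0 := T.height_pos m
  rw [← abs_of_nonneg (mul_nonneg dist_nonneg h0.le), ← sq_eq_sq_iff_abs_eq_abs, mul_pow,
    dist_comm, dist_eq_norm, EuclideanSpace.norm_sq_eq, ← cross_eq_area2 T m, cross]
  simp only [Fin.sum_univ_two, Real.norm_eq_abs, sq_abs, PiLp.sub_apply, edgeA, edgeB] at h1 h2 ⊢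
  set n0 := normal T m 0
  set n1 := normal T m 1
  set a0 := T.points (m + 1) 0
  set a1 := T.points (m + 1) 1
  set b0 := T.points (m + 2) 0
  set b1 := T.points (m + 2) 1
  set c0 := T.points m 0
  set c1 := T.points m 1
  set h := T.height m
  have he : (b0 - a0) * n0 + (b1 - a1) * n1 = 0 := by linear_combination h2 - h1
  -- The edge vector is orthogonal to the unit normal, hence it is ε times the normal turned by a
  -- right angle; ε is the signed edge length.
  set ε := -(b0 - a0) * n1 + (b1 - a1) * n0 with hε
  have e0 : b0 - a0 = -ε * n1 := by linear_combination (-(b0 - a0)) * h3 + n0 * he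
  have e1 : b1 - a1 = ε * n0 := by linear_combination (-(b1 - a1)) * h3 + n1 * he
  have hD : (a0 - c0) * (b1 - c1) - (a1 - c1) * (b0 - c0) = ε * h := by
    linear_combination (a0 - c0) * e1 - (a1 - c1) * e0 + ε * h1
  rw [hD, e0, e1]
  linear_combination ε ^ 2 * h ^ 2 * h3

/-- A plane vector that is orthogonal to the edges of a triangle is zero. -/
theorem eq_zero_of_sum_mul_eq_zero {w : Fin 2 → ℝ}
    (h : ∀ m, ∑ i, (T.points (m + 1) - T.points m) i * w i = 0) : w = 0 := by
  have h0 := h 0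
  have h2 := h 2
  have hD := area2_ne_zero T
  simp only [area2, cross, Fin.sum_univ_two, PiLp.sub_apply] at h0 h2 hD
  rw [show (0 : Fin 3) + 1 = 1 from rfl] at h0
  rw [show (2 : Fin 3) + 1 = 0 from rfl] at h2
  ext i
  apply (mul_eq_zero.1 _).resolve_left hD
  fin_cases i
  · simp only [Fin.zero_eta]
    linear_combination (T.points 2 1 - T.points 0 1) * h0 + (T.points 1 1 - T.points 0 1) * h2
  · simp only [Fin.mk_one]
    linear_combination -(T.points 2 0 - T.points 0 0) * h0 - (T.points 1 0 - T.points 0 0) * h2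

/-- The difference of both sides, as a vector in i, is orthogonal to every edge vector. Against
x_{j+1} - x_j, the normals of edges j, j + 1, j + 2 give plus the height, minus the height and zero;
base times height is `|area2 T|` on each edge, which is exactly `setIntegral_directional`. -/
theorem setIntegral_pderiv (f : Poly) (i : Fin 2) :
    ∫ x in T.closedInterior, ev (MvPolynomial.pderiv i f) x =
      ∑ m, dist (edgeA T m) (edgeB T m) * normal T m i *
        ∫ t in (0 : ℝ)..1, ev f (AffineMap.lineMap (edgeA T m) (edgeB T m) t) := by
  suffices h : (fun i => (∫ x in T.closedInterior, ev (MvPolynomial.pderiv i f) x) -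
      ∑ m, dist (edgeA T m) (edgeB T m) * normal T m i *
        ∫ t in (0 : ℝ)..1, ev f (AffineMap.lineMap (edgeA T m) (edgeB T m) t)) = 0 from
    sub_eq_zero.1 (congrFun h i)
  apply eq_zero_of_sum_mul_eq_zero T
  intro j
  have hdir := setIntegral_directional T j f
  have hint : ∀ i ∈ (Finset.univ : Finset (Fin 2)), IntegrableOn (fun x : Plane =>
      (T.points (j + 1) - T.points j) i * ev (MvPolynomial.pderiv i f) x) T.closedInterior :=
    fun i _ => integrableOn_closedInterior T (continuous_const.mul (continuous_ev _))
  rw [integral_finsetSum _ hint] at hdir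
  simp only [integral_const_mul] at hdir
  simp only [mul_sub, Finset.sum_sub_distrib, hdir, sub_eq_zero]
  rw [Finset.sum_congr rfl fun i _ => congrArg _ (sum_fin_three j _)]
  obtain ⟨hj1, hj2, hj3, hj4⟩ := (by decide : ∀ j : Fin 3,
    j ≠ j + 1 ∧ j + 1 ≠ j ∧ j + 2 ≠ j ∧ j + 2 ≠ j + 1) j
  have n0 := sum_mul_normal T hj1
  have n1 := sum_mul_normal T hj2
  have n2 := sum_mul_normal T hj3
  have n3 := sum_mul_normal T hj4
  have b0 := dist_mul_height T j
  have b1 := dist_mul_height T (j + 1)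
  simp only [Fin.sum_univ_two, PiLp.sub_apply] at n0 n1 n2 n3 ⊢
  generalize (∫ t in (0 : ℝ)..1, ev f (AffineMap.lineMap (edgeA T j) (edgeB T j) t)) = I0
  generalize (∫ t in (0 : ℝ)..1,
    ev f (AffineMap.lineMap (edgeA T (j + 1)) (edgeB T (j + 1)) t)) = I1
  generalize (∫ t in (0 : ℝ)..1,
    ev f (AffineMap.lineMap (edgeA T (j + 2)) (edgeB T (j + 2)) t)) = I2
  generalize dist (edgeA T j) (edgeB T j) = d0 at *
  generalize dist (edgeA T (j + 1)) (edgeB T (j + 1)) = d1 at *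
  generalize dist (edgeA T (j + 2)) (edgeB T (j + 2)) = d2 at *
  linear_combination (-I0) * b0 + I1 * b1 - d0 * I0 * n0 + d1 * I1 * n1 - d2 * I2 * (n3 - n2)

theorem edgeIntegral_mul_normal (m : Fin 3) (p : Poly) (τ : VPoly) :
    edgeIntegral T m (fun x => ev p x * ∑ i, ev (τ i) x * normal T m i) =
      ∑ i, dist (edgeA T m) (edgeB T m) * normal T m i *
        ∫ t in (0 : ℝ)..1, ev (p * τ i) (AffineMap.lineMap (edgeA T m) (edgeB T m) t) := by
  have hc : ∀ i, IntervalIntegrable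
      (fun t : ℝ => ev (p * τ i) (AffineMap.lineMap (edgeA T m) (edgeB T m) t)) volume 0 1 :=
    fun i => ((continuous_ev _).comp AffineMap.lineMap_continuous).intervalIntegrable _ _
  rw [edgeIntegral]
  simp only [mul_assoc, ← Finset.mul_sum]
  congr 1
  simp only [← intervalIntegral.integral_const_mul]
  rw [← intervalIntegral.integral_finsetSum fun i _ => (hc i).const_mul _]
  congr 1
  ext t
  simp only [ev_mul, Finset.mul_sum]
  exact Finset.sum_congr rfl fun i _ => by ring

/-- The gradient of a polynomial. -/
def grad (p : Poly) : VPoly := fun i => MvPolynomial.pderiv i p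

/-- Integration by parts on a triangle. -/
theorem integral_mul_divergence (p : Poly) (τ : VPoly) :
    (∫ x in T.closedInterior, ev p x * ev (divergence τ) x) + innerT T (grad p) τ =
      ∑ m, edgeIntegral T m (fun x => ev p x * ∑ i, ev (τ i) x * normal T m i) := by
  simp only [edgeIntegral_mul_normal]
  rw [Finset.sum_comm]
  simp only [← setIntegral_pderiv]
  rw [← integral_finsetSum _ fun i _ => integrableOn_closedInterior T (continuous_ev _), innerT,
    ← integral_add]
  · congr 1
    ext x
    simp only [divergence, grad, ev_sum, Finset.mul_sum, ← Finset.sum_add_distrib,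
      Derivation.leibniz, smul_eq_mul, ev_add, ev_mul]
    exact Finset.sum_congr rfl fun i _ => by ring
  · exact integrableOn_closedInterior T ((continuous_ev _).mul (continuous_ev _))
  · exact integrableOn_closedInterior T (continuous_finsetSum _ fun i _ =>
      (continuous_ev _).mul (continuous_ev _))

end Normal

/-! ### Degree bounds, and polynomials with zero gradient. -/

section Degrees

theorem C_mem_P (k : ℕ) (c : ℝ) : MvPolynomial.C c ∈ P k := by
  rw [MvPolynomial.mem_restrictTotalDegree, MvPolynomial.totalDegree_C]
  exact Nat.zero_le k

theorem X_mem_P (i : Fin 2) : (MvPolynomial.X i : Poly) ∈ P 1 := by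
  rw [MvPolynomial.mem_restrictTotalDegree, MvPolynomial.totalDegree_X]

theorem P_mono {k l : ℕ} (h : k ≤ l) {p : Poly} (hp : p ∈ P k) : p ∈ P l := by
  rw [MvPolynomial.mem_restrictTotalDegree] at hp ⊢
  exact hp.trans h

theorem mul_mem_P {k l : ℕ} {p q : Poly} (hp : p ∈ P k) (hq : q ∈ P l) : p * q ∈ P (k + l) := by
  rw [MvPolynomial.mem_restrictTotalDegree] at hp hq ⊢
  exact (MvPolynomial.totalDegree_mul p q).trans (add_le_add hp hq)

theorem C_mul_mem_P {k : ℕ} (c : ℝ) {p : Poly} (hp : p ∈ P k) : MvPolynomial.C c * p ∈ P k := by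
  rw [MvPolynomial.C_mul']
  exact Submodule.smul_mem _ _ hp

theorem pderiv_mem_P {k : ℕ} {p : Poly} (hp : p ∈ P (k + 1)) (i : Fin 2) :
    MvPolynomial.pderiv i p ∈ P k := by
  rw [MvPolynomial.mem_restrictTotalDegree] at hp
  rw [p.as_sum, map_sum]
  refine Submodule.sum_mem _ fun s hs => ?_
  rw [MvPolynomial.pderiv_monomial]
  by_cases h0 : s i = 0
  · simp [h0]
  · rw [MvPolynomial.mem_restrictTotalDegree]
    refine (MvPolynomial.totalDegree_monomial_le _ _).trans ?_
    have h1 := (MvPolynomial.le_totalDegree hs).trans hp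
    rw [Finsupp.sum_fintype _ _ fun _ => rfl, Fin.sum_univ_two] at h1 ⊢
    fin_cases i <;> simp at h0 ⊢ <;> omega

theorem bary_mem_P (T : Affine.Triangle ℝ Plane) (m : Fin 3) : bary T m ∈ P 1 := by
  refine C_mul_mem_P _ (Submodule.sub_mem _ (C_mul_mem_P _ ?_) (C_mul_mem_P _ ?_)) <;>
  exact Submodule.sub_mem _ (X_mem_P _) (C_mem_P _ _)

/-- A polynomial with zero gradient is constant. -/
theorem eq_C_of_grad_eq_zero {p : Poly} (h : grad p = 0) (x : Plane) :
    p = MvPolynomial.C (ev p x) := by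
  have hconst : ∀ y, ev p y = ev p x := by
    intro y
    have hd : ∀ s : ℝ, HasDerivAt (fun s : ℝ => ev p (x + s • (y - x))) 0 s := by
      intro s
      have hi : ∀ i, MvPolynomial.pderiv i p = 0 := fun i => congrFun h i
      simpa [hi] using hasDerivAt_ev p x (y - x) s
    have := is_const_of_deriv_eq_zero (fun s => (hd s).differentiableAt) (fun s => (hd s).deriv) 1 0
    simpa using this
  refine MvPolynomial.funext fun y => ?_
  rw [MvPolynomial.eval_C]
  exact hconst (WithLp.toLp 2 y)

end Degrees

/-! ### Raviart–Thomas test fields and the local kernel argument. -/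

section RaviartThomas

variable (T : Affine.Triangle ℝ Plane)

/-- The vector field `(x - x_m) q`, where `x_m` is the `m`-th vertex of `T`. -/
def radial (m : Fin 3) (q : Poly) : VPoly :=
  fun i => (MvPolynomial.X i - MvPolynomial.C (T.points m i)) * q

theorem radial_mem_RT {k : ℕ} (m : Fin 3) {q : Poly} (hq : q ∈ P k) : radial T m q ∈ RT k := by
  refine ⟨fun i => -(MvPolynomial.C (T.points m i) * q), q, fun i => ?_, hq, fun i => ?_⟩
  · exact Submodule.neg_mem _ (C_mul_mem_P _ hq)
  · simp only [radial]; ring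

theorem sum_sub_mul_normal_self (m : Fin 3) (t : ℝ) :
    ∑ i, ((AffineMap.lineMap (edgeA T m) (edgeB T m) t : Plane) i - T.points m i) *
      normal T m i = T.height m := by
  obtain ⟨h1, h2⟩ := (by decide : ∀ m : Fin 3, m ≠ m + 1 ∧ m ≠ m + 2) m
  have e1 := sum_mul_normal T h1
  have e2 := sum_mul_normal T h2
  simp only [AffineMap.lineMap_apply_module, edgeA, edgeB, Fin.sum_univ_two, PiLp.sub_apply,
    PiLp.add_apply, PiLp.smul_apply, smul_eq_mul] at e1 e2 ⊢
  linear_combination (1 - t) * e1 + t * e2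

theorem sum_sub_mul_normal_ne {m j : Fin 3} (h : m ≠ j) (t : ℝ) :
    ∑ i, ((AffineMap.lineMap (edgeA T m) (edgeB T m) t : Plane) i - T.points j i) *
      normal T m i = 0 := by
  have e1 := sum_mul_normal T h
  have e2 := sum_sub_mul_normal_self T m t
  simp only [Fin.sum_univ_two, PiLp.sub_apply] at e1 e2 ⊢
  linear_combination e2 - e1

/-- The normal component of x - x_j is zero on the two edges through x_j and equals the height on
the opposite edge. Radial fields thus act on one edge at a time. -/
theorem sum_ev_radial_mul_normal (m j : Fin 3) (q : Poly) (t : ℝ) :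
    ∑ i, ev (radial T j q i) (AffineMap.lineMap (edgeA T m) (edgeB T m) t) * normal T m i =
      if m = j then T.height m * ev q (AffineMap.lineMap (edgeA T m) (edgeB T m) t) else 0 := by
  set x : Plane := AffineMap.lineMap (edgeA T m) (edgeB T m) t with hx
  have h : ∑ i, ev (radial T j q i) x * normal T m i =
      (∑ i, (x i - T.points j i) * normal T m i) * ev q x := by
    rw [Finset.sum_mul]
    refine Finset.sum_congr rfl fun i _ => ?_
    simp only [radial, ev_mul, ev_sub, ev_X, ev_C]
    ring
  rw [h]
  split_ifs with hm
  · rw [← hm, sum_sub_mul_normal_self]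
  · rw [sum_sub_mul_normal_ne T hm, zero_mul]

theorem edgeIntegral_congr (m : Fin 3) {φ ψ : Plane → ℝ}
    (h : ∀ t : ℝ, φ (AffineMap.lineMap (edgeA T m) (edgeB T m) t) =
      ψ (AffineMap.lineMap (edgeA T m) (edgeB T m) t)) :
    edgeIntegral T m φ = edgeIntegral T m ψ := by
  simp only [edgeIntegral, h]

@[simp] theorem edgeIntegral_zero (m : Fin 3) : edgeIntegral T m (fun _ => 0) = 0 := by
  simp [edgeIntegral]

theorem eq_zero_on_interior_of_integral_eq_zero {φ : Plane → ℝ} (hφ : Continuous φ)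
    (h0 : ∀ x ∈ T.closedInterior, 0 ≤ φ x) (hint : ∫ x in T.closedInterior, φ x = 0) :
    ∀ x ∈ interior T.closedInterior, φ x = 0 := by
  rw [setIntegral_eq_zero_iff_of_nonneg_ae
    (ae_restrict_of_forall_mem (measurableSet_closedInterior T) h0)
    (integrableOn_closedInterior T hφ)] at hint
  have h1 : φ =ᵐ[volume.restrict (interior T.closedInterior)] (fun _ => (0 : ℝ)) :=
    ae_restrict_of_ae_restrict_of_subset interior_subset hint
  exact Measure.eqOn_open_of_ae_eq h1 isOpen_interior hφ.continuousOn continuous_const.continuousOn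

theorem eq_zero_on_edge_of_integral_eq_zero (m : Fin 3) (q : Poly)
    (h : ∫ t in (0 : ℝ)..1, ev q (AffineMap.lineMap (edgeA T m) (edgeB T m) t) ^ 2 = 0) :
    ∀ x ∈ edge T m, ev q x = 0 := by
  intro x hx
  rw [edge, segment_eq_image_lineMap] at hx
  obtain ⟨t, ht, rfl⟩ := hx
  by_contra hne
  refine (intervalIntegral.integral_pos zero_lt_one
    (((continuous_ev q).comp AffineMap.lineMap_continuous).pow 2).continuousOn
    (fun _ _ => sq_nonneg _) ⟨t, ht, ?_⟩).ne' h
  exact even_two.pow_pos hne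

/-- If `(∇p, τ)_T = ∑ ⟨j_m, τ·n⟩` for all Raviart–Thomas fields `τ`, then `∇p = 0` and all `j_m`
vanish on their edges. -/
theorem grad_eq_zero_of_forall_innerT_eq {k : ℕ} (hk : 1 ≤ k) {p : Poly} (hp : p ∈ P k)
    {j : Fin 3 → Poly} (hj : ∀ m, j m ∈ P k)
    (h : ∀ τ ∈ RT k, innerT T (grad p) τ =
      ∑ m, edgeIntegral T m (fun x => ev (j m) x * ∑ i, ev (τ i) x * normal T m i)) :
    grad p = 0 ∧ ∀ m, ∀ x ∈ edge T m, ev (j m) x = 0 := by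
  obtain ⟨l, rfl⟩ := Nat.exists_eq_add_of_le' hk
  have hgrad : grad p = 0 := by
    -- The factor λ_m kills the only normal trace of the m-th radial field. It raises the degree by
    -- one, which the derivative in `grad p` has lowered.
    set q : Fin 3 → Poly := fun m =>
      -(bary T m * ∑ i, MvPolynomial.C (T.points m i) * grad p i) with hq
    have hqP : ∀ m, q m ∈ P (l + 1) := fun m => by
      rw [add_comm]
      exact Submodule.neg_mem _ (mul_mem_P (bary_mem_P T m)
        (Submodule.sum_mem _ fun i _ => C_mul_mem_P _ (pderiv_mem_P hp i)))
    have hτ := h (∑ m, radial T m (q m))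
      (Submodule.sum_mem _ fun m _ => radial_mem_RT T m (hqP m))
    have hzero : ∀ m, edgeIntegral T m (fun x => ev (j m) x *
        ∑ i, ev ((∑ n, radial T n (q n)) i) x * normal T m i) = 0 := by
      intro m
      rw [← edgeIntegral_zero T m]
      refine edgeIntegral_congr T m fun t => ?_
      simp only [Finset.sum_apply, ev_sum, Finset.sum_mul]
      rw [Finset.sum_comm]
      simp only [sum_ev_radial_mul_normal]
      have hl : ev (bary T m) (AffineMap.lineMap (edgeA T m) (edgeB T m) t) = 0 := by
        rw [ev_bary_lineMap, edgeA, edgeB]; simp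
      simp [hq, hl]
    simp only [hzero, Finset.sum_const_zero] at hτ
    set w : Plane → Fin 2 → ℝ := fun x i => ev (grad p i) x with hw
    -- Variance formula: with y_m = x_m·w and mean x·w, ∑ λ_m y_m (y_m - x·w) = ∑ λ_m (y_m - x·w)².
    have hF : ∀ x, ∑ i, ev (grad p i) x * ev ((∑ m, radial T m (q m)) i) x =
        ∑ m, ev (bary T m) x * (∑ i, (T.points m i - x i) * w x i) ^ 2 := by
      intro x
      have h1 := sum_ev_bary T x
      have h2 := sum_ev_bary_smul T x
      have h20 := congrArg (fun y : Plane => y 0) h2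
      have h21 := congrArg (fun y : Plane => y 1) h2
      simp only [Fin.sum_univ_three, PiLp.add_apply, PiLp.smul_apply, smul_eq_mul] at h1 h20 h21
      simp only [Finset.sum_apply, radial, hq, hw, Fin.sum_univ_two, Fin.sum_univ_three,
        ev_mul, ev_neg, ev_add, ev_sub, ev_X, ev_C]
      generalize ev (bary T 0) x = a at *
      generalize ev (bary T 1) x = b at *
      generalize ev (bary T 2) x = c at *
      generalize ev (grad p 0) x = w0 at *
      generalize ev (grad p 1) x = w1 at *
      generalize x 0 = X at *
      generalize x 1 = Y at *
      linear_combination (-(X * w0 + Y * w1) ^ 2) * h1 +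
        (X * w0 + Y * w1) * w0 * h20 + (X * w0 + Y * w1) * w1 * h21
    rw [innerT] at hτ
    simp only [hF] at hτ
    have hcont : Continuous fun x => ∑ m, ev (bary T m) x *
        (∑ i, (T.points m i - x i) * w x i) ^ 2 := by
      refine continuous_finsetSum _ fun m _ => (continuous_ev _).mul (Continuous.pow ?_ 2)
      refine continuous_finsetSum _ fun i _ => Continuous.mul ?_ (continuous_ev _)
      fun_prop
    have hF0 := eq_zero_on_interior_of_integral_eq_zero T hcont (fun x hx =>
      Finset.sum_nonneg fun m _ =>
        mul_nonneg ((mem_closedInterior_iff T x).1 hx m) (sq_nonneg _)) hτ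
    have hw0 : ∀ x ∈ {x | ∀ m, 0 < ev (bary T m) x}, w x = 0 := by
      intro x hx
      have hx0 := hF0 x (bary_pos_subset_interior T hx)
      rw [Finset.sum_eq_zero_iff_of_nonneg fun m _ => mul_nonneg (hx m).le (sq_nonneg _)] at hx0
      have hm : ∀ m, ∑ i, (T.points m i - x i) * w x i = 0 := fun m =>
        pow_eq_zero_iff two_ne_zero |>.1
          ((mul_eq_zero.1 (hx0 m (Finset.mem_univ m))).resolve_left (hx m).ne')
      refine eq_zero_of_sum_mul_eq_zero T fun m => ?_
      have e1 := hm m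
      have e2 := hm (m + 1)
      simp only [Fin.sum_univ_two, PiLp.sub_apply] at e1 e2 ⊢
      linear_combination e2 - e1
    ext1 i
    exact eq_zero_of_ev_eq_zero_on_open (isOpen_bary_pos T) (nonempty_bary_pos T)
      fun x hx => congrFun (hw0 x hx) i
  refine ⟨hgrad, fun m => eq_zero_on_edge_of_integral_eq_zero T m (j m) ?_⟩
  -- Now that ∇p = 0, the field (x - x_m) j_m sees edge m only and yields `|area2 T|` ∫ j_m² = 0.
  have hτ := h _ (radial_mem_RT T m (hj m))
  have h0 : innerT T (grad p) (radial T m (j m)) = 0 := by simp [innerT, hgrad]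
  rw [h0, Finset.sum_eq_single m] at hτ
  · simp only [edgeIntegral, sum_ev_radial_mul_normal, if_true] at hτ
    have hD := area2_ne_zero T
    rw [← abs_ne_zero, ← dist_mul_height T m] at hD
    have e : ∀ t : ℝ, ev (j m) (AffineMap.lineMap (edgeA T m) (edgeB T m) t) *
        (T.height m * ev (j m) (AffineMap.lineMap (edgeA T m) (edgeB T m) t)) =
        T.height m * ev (j m) (AffineMap.lineMap (edgeA T m) (edgeB T m) t) ^ 2 :=
      fun t => by ring
    simp only [e, intervalIntegral.integral_const_mul] at hτ
    rw [← mul_assoc] at hτ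
    exact (mul_eq_zero.1 hτ.symm).resolve_left hD
  · intro n _ hn
    rw [← edgeIntegral_zero T n]
    refine edgeIntegral_congr T n fun t => ?_
    rw [sum_ev_radial_mul_normal, if_neg hn, mul_zero]
  · simp

end RaviartThomas

/-! ### Triangles that share an edge. -/

section Neighbours

theorem ev_bary_eq_sum (T S : Affine.Triangle ℝ Plane) (n : Fin 3) (y : Plane) :
    ev (bary S n) y = ∑ i, ev (bary T i) y * ev (bary S n) (T.points i) := by
  have h1 := sum_ev_bary T y
  have h2 := sum_ev_bary_smul T y
  conv_lhs => rw [← h2]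
  rw [Fin.sum_univ_three] at h1
  have h0 : ev (bary T 0) y = 1 - ev (bary T 1) y - ev (bary T 2) y := by linarith
  simp only [h0, Fin.sum_univ_three, ev_bary S, cross]
  simp
  ring

/-- If `S` has the `m`-th edge of `T`, then the barycentric coordinate of `S` that vanishes on this
edge is a multiple of the one of `T`. -/
theorem exists_bary_eq_mul (T S : Affine.Triangle ℝ Plane) (m : Fin 3)
    (hA : edgeA T m ∈ range S.points) (hB : edgeB T m ∈ range S.points) :
    ∃ (l : Fin 3) (κ : ℝ), κ ≠ 0 ∧ (∀ y, ev (bary S l) y = κ * ev (bary T m) y) ∧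
      ∀ y, 0 < ev (bary T (m + 1)) y → 0 < ev (bary T (m + 2)) y → ev (bary T m) y = 0 →
        ∀ n, n ≠ l → 0 < ev (bary S n) y := by
  obtain ⟨i, hi⟩ := hA
  obtain ⟨j, hj⟩ := hB
  have hij : i ≠ j := by
    rintro rfl
    have h : T.points (m + 1) = T.points (m + 2) := hi.symm.trans hj
    exact (by decide : ∀ m : Fin 3, m + 1 ≠ m + 2) m (T.independent.injective h)
  -- l is the vertex of S off the common edge. The factor κ will be its coordinate at the vertex of
  -- T off that edge, so the sign of κ tells on which side S lies.
  obtain ⟨l, hl⟩ := (by decide : ∀ i j : Fin 3, i ≠ j →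
    ∃ l, l ≠ i ∧ l ≠ j ∧ ∀ n, n ≠ l → n = i ∨ n = j) i j hij
  have key : ∀ n y, ev (bary S n) y = ev (bary T m) y * ev (bary S n) (T.points m) +
      ev (bary T (m + 1)) y * (if n = i then 1 else 0) +
      ev (bary T (m + 2)) y * (if n = j then 1 else 0) := by
    intro n y
    rw [ev_bary_eq_sum T S n y, sum_fin_three m, ← ev_bary_vertex S, ← ev_bary_vertex S, hi, hj,
      edgeA, edgeB]
  have hκ : ∀ y, ev (bary S l) y = ev (bary S l) (T.points m) * ev (bary T m) y := by
    intro y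
    rw [key l y, if_neg hl.1, if_neg hl.2.1]
    ring
  refine ⟨l, ev (bary S l) (T.points m), fun h0 => ?_, hκ, ?_⟩
  · have h1 := hκ (S.points l)
    rw [h0, zero_mul, ev_bary_self] at h1
    exact one_ne_zero h1
  · intro y h1 h2 h0 n hn
    rw [key n y, h0]
    rcases hl.2.2 n hn with rfl | rfl
    · simpa [hij] using h1
    · simpa [hij.symm] using h2

theorem isOpen_forall_ne_bary_pos (T : Affine.Triangle ℝ Plane) (m : Fin 3) :
    IsOpen {y | ∀ n, n ≠ m → 0 < ev (bary T n) y} := by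
  simp only [ofPred_forall]
  exact isOpen_iInter_of_finite fun n => isOpen_iInter_of_finite fun _ =>
    isOpen_lt continuous_const (continuous_ev _)

theorem bary_pos_of_ne {T : Affine.Triangle ℝ Plane} {m : Fin 3} {y : Plane}
    (h : ∀ n, n ≠ m → 0 < ev (bary T n) y) (hm : 0 < ev (bary T m) y) :
    ∀ n, 0 < ev (bary T n) y := fun n => by
  by_cases hn : n = m
  · rwa [hn]
  · exact h n hn

/-- Two triangles on the same side of a common edge overlap. -/
theorem not_disjoint_interior {S T : Affine.Triangle ℝ Plane} {l m : Fin 3} {κ : ℝ} (hκ : 0 < κ)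
    (hST : ∀ y, ev (bary S l) y = κ * ev (bary T m) y) {x : Plane} (hx : ev (bary T m) x = 0)
    (hS : ∀ n, n ≠ l → 0 < ev (bary S n) x) (hT : ∀ n, n ≠ m → 0 < ev (bary T n) x) :
    ¬ Disjoint (interior S.closedInterior) (interior T.closedInterior) := by
  have hopen := (isOpen_forall_ne_bary_pos S l).inter (isOpen_forall_ne_bary_pos T m)
  -- Moving slightly from x towards the vertex of T opposite the edge makes the remaining coordinate
  -- positive in T, and in S as well because κ > 0.
  have hγ : Continuous fun t : ℝ => (AffineMap.lineMap x (T.points m) t : Plane) :=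
    AffineMap.lineMap_continuous
  have hpre := (hopen.preimage hγ).mem_nhds (x := 0) (by
    simp only [mem_preimage, AffineMap.lineMap_apply_zero]; exact ⟨hS, hT⟩)
  obtain ⟨ε, hε, hball⟩ := Metric.mem_nhds_iff.1 hpre
  have hmem := hball (show ε / 2 ∈ Metric.ball (0 : ℝ) ε by
    rw [Metric.mem_ball, Real.dist_0_eq_abs, abs_of_pos (by linarith)]; linarith)
  obtain ⟨h1, h2⟩ := hmem
  set y : Plane := AffineMap.lineMap x (T.points m) (ε / 2) with hy
  have hm : 0 < ev (bary T m) y := by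
    rw [hy, ev_bary_lineMap, hx, ev_bary_self]; linarith
  have hl : 0 < ev (bary S l) y := by rw [hST]; exact mul_pos hκ hm
  rw [not_disjoint_iff]
  exact ⟨y, bary_pos_subset_interior S (bary_pos_of_ne h1 hl),
    bary_pos_subset_interior T (bary_pos_of_ne h2 hm)⟩

/-- Two triangles on different sides of a common edge cover a neighbourhood of each of its inner
points. -/
theorem union_mem_nhds {S T : Affine.Triangle ℝ Plane} {l m : Fin 3} {κ : ℝ} (hκ : κ < 0)
    (hST : ∀ y, ev (bary S l) y = κ * ev (bary T m) y) {x : Plane}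
    (hS : ∀ n, n ≠ l → 0 < ev (bary S n) x) (hT : ∀ n, n ≠ m → 0 < ev (bary T n) x) :
    S.closedInterior ∪ T.closedInterior ∈ nhds x := by
  have hopen := (isOpen_forall_ne_bary_pos S l).inter (isOpen_forall_ne_bary_pos T m)
  refine Filter.mem_of_superset (hopen.mem_nhds ⟨hS, hT⟩) ?_
  rintro y ⟨h1, h2⟩
  rcases le_or_gt 0 (ev (bary T m) y) with h | h
  · right
    rw [mem_closedInterior_iff]
    intro n
    by_cases hn : n = m
    · rwa [hn]
    · exact (h2 n hn).le
  · left
    rw [mem_closedInterior_iff]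
    intro n
    by_cases hn : n = l
    · rw [hn, hST]; exact (mul_pos_of_neg_of_neg hκ h).le
    · exact (h1 n hn).le

end Neighbours

/-! ### Piecewise constants that agree with their edge averages. -/

section PiecewiseConstant

variable {Ω : Set Plane}

theorem isConnected_compl_of_finite {F : Set Plane} (hF : F.Finite) : IsConnected Fᶜ := by
  refine hF.countable.isConnected_compl_of_one_lt_rank ?_
  rw [← Module.finrank_eq_rank, finrank_euclideanSpace]
  norm_num

/-- Otherwise Fᶜ would be split by the disjoint open sets `interior K` and Kᶜ. Both meet Fᶜ: the
first since Fᶜ is dense, the second since the plane is not compact. -/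
theorem frontier_not_subset_finite {K F : Set Plane} (hK : IsCompact K)
    (hne : (interior K).Nonempty) (hF : F.Finite) : ¬ frontier K ⊆ F := by
  intro hsub
  have hcover : Fᶜ ⊆ interior K ∪ Kᶜ := by
    intro x hx
    by_cases hxK : x ∈ K
    · left
      by_contra hxi
      exact hx (hsub ⟨subset_closure hxK, hxi⟩)
    · exact Or.inr hxK
  have h1 : (Fᶜ ∩ interior K).Nonempty := by
    rw [inter_comm]
    exact (hF.countable.dense_compl ℝ).inter_open_nonempty _ isOpen_interior hne
  have h2 : (Fᶜ ∩ Kᶜ).Nonempty := by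
    rw [← compl_union]
    by_contra hemp
    rw [not_nonempty_iff_eq_empty, compl_empty_iff] at hemp
    exact NoncompactSpace.noncompact_univ (X := Plane) (hemp ▸ hF.isCompact.union hK)
  obtain ⟨x, _, hx1, hx2⟩ := (isConnected_compl_of_finite hF).isPreconnected _ _ isOpen_interior
    hK.isClosed.isOpen_compl hcover h1 h2
  exact hx2 (interior_subset hx1)

open Classical in
/-- A piecewise constant function that vanishes on boundary edges and agrees with its average on
interior edges is zero. -/
theorem eq_zero_of_eq_average (𝒯 : Triangulation Ω) (c : 𝒯.triangles → ℝ)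
    (hbd : ∀ (T : 𝒯.triangles) (m : Fin 3), IsBoundaryEdge Ω T m → c T = 0)
    (hint : ∀ (T : 𝒯.triangles) (m : Fin 3), ¬ IsBoundaryEdge Ω T m →
      c T = (1 / 2 : ℝ) * ∑ S : 𝒯.triangles,
        if edgeA T.1 m ∈ range S.1.points ∧ edgeB T.1 m ∈ range S.1.points then c S else 0) :
    c = 0 := by
  by_contra hc
  obtain ⟨T₀, hT₀⟩ := Function.ne_iff.1 hc
  rw [Pi.zero_apply] at hT₀
  -- K collects the triangles that carry one nonzero value; its frontier will turn out to contain
  -- only vertices.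
  set K : Set Plane := ⋃ S ∈ {S : 𝒯.triangles | c S = c T₀}, S.1.closedInterior with hKdef
  have hsubK : ∀ S : 𝒯.triangles, c S = c T₀ → S.1.closedInterior ⊆ K := fun S hS =>
    subset_biUnion_of_mem (u := fun S : 𝒯.triangles => S.1.closedInterior)
      (show S ∈ {S : 𝒯.triangles | c S = c T₀} from hS)
  have hK : IsCompact K := (toFinite _).isCompact_biUnion fun S _ => isCompact_closedInterior S.1
  have hne : (interior K).Nonempty :=
    (nonempty_interior T₀.1).mono (interior_mono (hsubK T₀ rfl))
  refine frontier_not_subset_finite hK hne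
    (F := ⋃ S : 𝒯.triangles, range S.1.points) (finite_iUnion fun S => finite_range _) ?_
  intro x hx
  by_contra hxF
  have hxK : x ∈ K := hK.isClosed.frontier_subset hx
  have hxi : x ∉ interior K := hx.2
  rw [hKdef, mem_iUnion₂] at hxK
  obtain ⟨T, hcT, hxT⟩ := hxK
  have hcT' : c T = c T₀ := hcT
  have hnn := (mem_closedInterior_iff T.1 x).1 hxT
  obtain ⟨m, hm⟩ : ∃ m, ev (bary T.1 m) x = 0 := by
    by_contra! hall
    exact hxi (interior_mono (hsubK T hcT') (bary_pos_subset_interior T.1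
      fun n => (hnn n).lt_of_ne (hall n).symm))
  have hvert : ∀ n, x ≠ T.1.points n := fun n h => hxF (mem_iUnion.2 ⟨T, n, h.symm⟩)
  have hs := sum_ev_bary T.1 x
  have hsx := sum_ev_bary_smul T.1 x
  rw [sum_fin_three m, hm, zero_add] at hs
  rw [sum_fin_three m, hm, zero_smul, zero_add] at hsx
  have hp1 : 0 < ev (bary T.1 (m + 1)) x := (hnn _).lt_of_ne fun h => by
    rw [← h, zero_add] at hs
    rw [← h, hs, zero_smul, one_smul, zero_add] at hsx
    exact hvert _ hsx.symm
  have hp2 : 0 < ev (bary T.1 (m + 2)) x := (hnn _).lt_of_ne fun h => by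
    rw [← h, add_zero] at hs
    rw [← h, hs, zero_smul, one_smul, add_zero] at hsx
    exact hvert _ hsx.symm
  have hTpos : ∀ n, n ≠ m → 0 < ev (bary T.1 n) x := by
    intro n hn
    rcases eq_or_eq_or_eq m n with rfl | rfl | rfl
    · exact absurd rfl hn
    · exact hp1
    · exact hp2
  set H : 𝒯.triangles → Prop := fun S =>
    edgeA T.1 m ∈ range S.1.points ∧ edgeB T.1 m ∈ range S.1.points with hH
  have hHT : H T := ⟨⟨m + 1, rfl⟩, ⟨m + 2, rfl⟩⟩
  -- Any other triangle with this edge lies on the far side, since two on one side would overlap.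
  have hopp : ∀ S, H S → S ≠ T → ∃ (l : Fin 3) (κ : ℝ), κ < 0 ∧
      (∀ y, ev (bary S.1 l) y = κ * ev (bary T.1 m) y) ∧
      ∀ n, n ≠ l → 0 < ev (bary S.1 n) x := by
    intro S hS hne
    obtain ⟨l, κ, hκ, hmul, hpos⟩ := exists_bary_eq_mul T.1 S.1 m hS.1 hS.2
    refine ⟨l, κ, ?_, hmul, hpos x hp1 hp2 hm⟩
    rcases hκ.lt_or_gt with h | h
    · exact h
    · exact absurd (𝒯.disjoint_interior S.1 S.2 T.1 T.2 fun h' => hne (Subtype.ext h'))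
        (not_disjoint_interior h hmul hm (hpos x hp1 hp2 hm) hTpos)
  have hnbd : ¬ IsBoundaryEdge Ω T m := fun hb => hT₀ (hcT' ▸ hbd T m hb)
  have havg := hint T m hnbd
  by_cases hex : ∃ S, H S ∧ S ≠ T
  · obtain ⟨S, hS, hST⟩ := hex
    obtain ⟨l, κ, hκ, hmul, hpos⟩ := hopp S hS hST
    -- S and T together cover a neighbourhood of x, so x would be interior to K if S belonged to K.
    have hcS : c S ≠ c T₀ := fun h => hxi (mem_interior_iff_mem_nhds.2
      (Filter.mem_of_superset (union_mem_nhds hκ hmul hpos hTpos)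
        (union_subset (hsubK S h) (hsubK T hcT'))))
    -- A third triangle would lie on the same side as S, with positive ratio κ' / κ, and overlap it.
    have honly : ∀ R, H R → R = S ∨ R = T := by
      intro R hR
      by_contra! hRne
      obtain ⟨l', κ', hκ', hmul', hpos'⟩ := hopp R hR hRne.2
      have hRS : ∀ y, ev (bary R.1 l') y = κ' / κ * ev (bary S.1 l) y := fun y => by
        rw [hmul, hmul']; field_simp [hκ.ne]
      exact not_disjoint_interior (div_pos_of_neg_of_neg hκ' hκ) hRS
        (by rw [hmul, hm, mul_zero]) hpos' hpos
        (𝒯.disjoint_interior R.1 R.2 S.1 S.2 fun h' => hRne.1 (Subtype.ext h'))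
    rw [← Finset.sum_filter] at havg
    have hfil : Finset.univ.filter (fun S : 𝒯.triangles => H S) = {S, T} := by
      ext R
      simp only [Finset.mem_filter, Finset.mem_univ, true_and, Finset.mem_insert,
        Finset.mem_singleton]
      exact ⟨honly R, by rintro (rfl | rfl) <;> assumption⟩
    rw [hfil, Finset.sum_pair hST] at havg
    exact hcS (by linarith)
  -- If T is alone at the edge, the average is half of c T, which forces c T = 0.
  · push Not at hex
    rw [Finset.sum_eq_single T (fun S _ hS => if_neg fun h => hS (hex S h)) (by simp),
      if_pos hHT] at havg
    exact hT₀ (by linarith)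

end PiecewiseConstant

/-! ### The local forms and Riesz representation. -/

section Functionals

variable (T : Affine.Triangle ℝ Plane)

/-- Integration of polynomials over a triangle. -/
def triangleFunctional : Poly →ₗ[ℝ] ℝ where
  toFun p := ∫ x in T.closedInterior, ev p x
  map_add' p q := by
    simp only [ev_add]
    exact integral_add (integrableOn_closedInterior T (continuous_ev p))
      (integrableOn_closedInterior T (continuous_ev q))
  map_smul' c p := by
    simp only [ev_smul, integral_const_mul, RingHom.id_apply, smul_eq_mul]

/-- Integration of polynomials over an edge, with respect to the edge parameter. -/
def edgeFunctional (m : Fin 3) : Poly →ₗ[ℝ] ℝ where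
  toFun p := ∫ t in (0 : ℝ)..1, ev p (AffineMap.lineMap (edgeA T m) (edgeB T m) t)
  map_add' p q := by
    simp only [ev_add]
    exact intervalIntegral.integral_add
      (((continuous_ev p).comp AffineMap.lineMap_continuous).intervalIntegrable _ _)
      (((continuous_ev q).comp AffineMap.lineMap_continuous).intervalIntegrable _ _)
  map_smul' c p := by
    simp only [ev_smul, intervalIntegral.integral_const_mul, RingHom.id_apply, smul_eq_mul]

theorem innerT_eq (σ τ : VPoly) : innerT T σ τ = triangleFunctional T (∑ i, σ i * τ i) := by
  simp [innerT, triangleFunctional]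

theorem innerT_comm (σ τ : VPoly) : innerT T σ τ = innerT T τ σ := by
  simp only [innerT, mul_comm]

/-- The inner product `(σ, τ)_T` as a bilinear form. -/
def innerForm : LinearMap.BilinForm ℝ VPoly :=
  LinearMap.mk₂ ℝ (innerT T)
    (fun σ σ' τ => by simp [innerT_eq, add_mul, Finset.sum_add_distrib])
    (fun c σ τ => by simp [innerT_eq, mul_add])
    (fun σ τ τ' => by simp [innerT_eq, mul_add, Finset.sum_add_distrib])
    (fun c σ τ => by simp [innerT_eq, mul_add])

@[simp] theorem innerForm_apply (σ τ : VPoly) : innerForm T σ τ = innerT T σ τ := rfl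

theorem innerT_self_nonneg (τ : VPoly) : 0 ≤ innerT T τ τ :=
  integral_nonneg fun _ => Finset.sum_nonneg fun _ _ => mul_self_nonneg _

theorem eq_zero_of_innerT_self {τ : VPoly} (h : innerT T τ τ = 0) : τ = 0 := by
  have h0 := eq_zero_on_interior_of_integral_eq_zero T
    (φ := fun x => ∑ i, ev (τ i) x * ev (τ i) x)
    (continuous_finsetSum _ fun i _ => (continuous_ev _).mul (continuous_ev _))
    (fun _ _ => Finset.sum_nonneg fun _ _ => mul_self_nonneg _) h
  ext1 i
  refine eq_zero_of_ev_eq_zero_on_open isOpen_interior (nonempty_interior T) fun x hx => ?_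
  have := h0 x hx
  rw [Finset.sum_eq_zero_iff_of_nonneg fun _ _ => mul_self_nonneg _] at this
  exact mul_self_eq_zero.1 (this i (Finset.mem_univ i))

theorem divergence_add (σ τ : VPoly) : divergence (σ + τ) = divergence σ + divergence τ := by
  simp [divergence, Finset.sum_add_distrib]

theorem divergence_smul (c : ℝ) (τ : VPoly) : divergence (c • τ) = c • divergence τ := by
  simp [divergence]

/-- The right-hand side `-(p, ∇·τ)_T + ∑ ⟨j_m, τ·n⟩` of the definition of the weak gradient, as a
bilinear function of the data `(p, j)` and the test field `τ`. -/
def weakRhs : Poly × (Fin 3 → Poly) →ₗ[ℝ] VPoly →ₗ[ℝ] ℝ :=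
  LinearMap.mk₂ ℝ
    (fun d τ => -triangleFunctional T (d.1 * divergence τ) +
      ∑ m, ∑ i, dist (edgeA T m) (edgeB T m) * normal T m i * edgeFunctional T m (d.2 m * τ i))
    (fun d d' τ => by
      simp only [Prod.fst_add, Prod.snd_add, Pi.add_apply, add_mul, map_add, mul_add,
        Finset.sum_add_distrib]
      ring)
    (fun c d τ => by
      simp only [Prod.smul_fst, Prod.smul_snd, Pi.smul_apply, smul_mul_assoc, map_smul,
        smul_eq_mul, mul_add, Finset.mul_sum, mul_neg]
      congr 1
      exact Finset.sum_congr rfl fun m _ => Finset.sum_congr rfl fun i _ => by ring)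
    (fun d τ τ' => by
      simp only [Pi.add_apply, divergence_add, map_add, mul_add, Finset.sum_add_distrib]
      ring)
    (fun c d τ => by
      simp only [Pi.smul_apply, divergence_smul, mul_smul_comm, map_smul,
        smul_eq_mul, mul_add, Finset.mul_sum, mul_neg]
      congr 1
      exact Finset.sum_congr rfl fun m _ => Finset.sum_congr rfl fun i _ => by ring)

theorem weakRhs_apply (p : Poly) (j : Fin 3 → Poly) (τ : VPoly) : weakRhs T (p, j) τ =
    -(∫ x in T.closedInterior, ev p x * ev (divergence τ) x) +
      ∑ m, edgeIntegral T m (fun x => ev (j m) x * ∑ i, ev (τ i) x * normal T m i) := by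
  simp only [edgeIntegral_mul_normal, ← ev_mul p]
  rfl

/-- Integration by parts separates the classical gradient from the jump p - j_m; this is the form in
which a vanishing weak gradient can be exploited. -/
theorem weakRhs_eq (p : Poly) (j : Fin 3 → Poly) (τ : VPoly) : weakRhs T (p, j) τ =
    innerT T (grad p) τ -
      ∑ m, edgeIntegral T m (fun x => ev (p - j m) x * ∑ i, ev (τ i) x * normal T m i) := by
  have h := integral_mul_divergence T p τ
  have hsub : ∀ m, edgeIntegral T m (fun x => ev (p - j m) x * ∑ i, ev (τ i) x * normal T m i) =
      edgeIntegral T m (fun x => ev p x * ∑ i, ev (τ i) x * normal T m i) -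
        edgeIntegral T m (fun x => ev (j m) x * ∑ i, ev (τ i) x * normal T m i) := by
    intro m
    simp only [edgeIntegral_mul_normal]
    rw [← Finset.sum_sub_distrib]
    refine Finset.sum_congr rfl fun i _ => ?_
    rw [← mul_sub, sub_mul]
    exact congrArg _ (map_sub (edgeFunctional T m) _ _)
  rw [weakRhs_apply]
  simp only [hsub, Finset.sum_sub_distrib]
  linarith

instance finiteDimensional_RT (k : ℕ) : FiniteDimensional ℝ (RT k) := by
  have hmem : ∀ (τ : RT k) (i : Fin 2), (τ : VPoly) i ∈ P (k + 1) := by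
    rintro ⟨τ, q, p, hq, hp, h⟩ i
    simp only [h]
    refine Submodule.add_mem _ (P_mono (Nat.le_succ k) (hq i)) ?_
    rw [add_comm]
    exact mul_mem_P (X_mem_P i) hp
  let L : RT k →ₗ[ℝ] (Fin 2 → P (k + 1)) := LinearMap.pi fun i =>
    ((LinearMap.proj i).comp (RT k).subtype).codRestrict (P (k + 1)) fun τ => hmem τ i
  refine FiniteDimensional.of_injective L fun σ τ h => ?_
  ext1
  funext i
  exact congrArg Subtype.val (congrFun h i)

/-- A definite bilinear form on a finite-dimensional space represents all linear functionals. -/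
theorem exists_bilinForm_eq {V : Type*} [AddCommGroup V] [Module ℝ V] [FiniteDimensional ℝ V]
    (B : LinearMap.BilinForm ℝ V) (hB : ∀ v, B v v = 0 → v = 0) (ℓ : V →ₗ[ℝ] ℝ) :
    ∃ g, ∀ v, B g v = ℓ v := by
  have hinj : Function.Injective B := by
    rw [injective_iff_map_eq_zero]
    intro v hv
    exact hB v (by rw [hv]; rfl)
  have hsurj := (LinearMap.injective_iff_surjective_of_finrank_eq_finrank
    (Subspace.dual_finrank_eq (K := ℝ) (V := V)).symm).1 hinj
  obtain ⟨g, hg⟩ := hsurj ℓ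
  exact ⟨g, fun v => by rw [hg]⟩

theorem exists_innerT_eq (k : ℕ) (ℓ : VPoly →ₗ[ℝ] ℝ) :
    ∃ g ∈ RT k, ∀ τ ∈ RT k, innerT T g τ = ℓ τ := by
  obtain ⟨g, hg⟩ := exists_bilinForm_eq ((innerForm T).restrict (RT k))
    (fun v hv => Subtype.ext (eq_zero_of_innerT_self T hv)) (ℓ.comp (RT k).subtype)
  exact ⟨g, g.2, fun τ hτ => hg ⟨τ, hτ⟩⟩

theorem eq_of_forall_innerT_eq {k : ℕ} {g g' : VPoly} (hg : g ∈ RT k) (hg' : g' ∈ RT k)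
    (h : ∀ τ ∈ RT k, innerT T g τ = innerT T g' τ) : g = g' := by
  rw [← sub_eq_zero]
  apply eq_zero_of_innerT_self T
  have h1 := h _ (Submodule.sub_mem _ hg hg')
  rw [← sub_eq_zero, ← innerForm_apply, ← innerForm_apply] at h1
  rw [← innerForm_apply, map_sub (innerForm T), LinearMap.sub_apply, h1]

end Functionals

/-! ### Elements of V_h as families of polynomials. -/

section Restriction

variable {Ω : Set Plane} {𝒯 : Triangulation Ω} {k : ℕ}

theorem closedInterior_subset_closure (T : 𝒯.triangles) : T.1.closedInterior ⊆ closure Ω := by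
  rw [← 𝒯.cover]
  exact subset_biUnion_of_mem (u := fun T : Affine.Triangle ℝ Plane => T.closedInterior) T.2

/-- T lies in the closure of Ω, so its interior meets Ω in a nonempty open set, where almost
everywhere equal polynomials coincide. Hence the chosen polynomial in `restr` is canonical, and
linear in v. -/
theorem IsRestr.unique (hΩ : IsOpen Ω) {v : L2 Ω} {T : 𝒯.triangles} {p q : Poly}
    (hp : IsRestr k v T.1 p) (hq : IsRestr k v T.1 q) : p = q := by
  have hU : IsOpen (interior T.1.closedInterior ∩ Ω) := isOpen_interior.inter hΩ
  have hne : (interior T.1.closedInterior ∩ Ω).Nonempty := by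
    obtain ⟨x, hx⟩ := nonempty_interior T.1
    exact mem_closure_iff.1 (closedInterior_subset_closure T (interior_subset hx)) _
      isOpen_interior hx
  have hae : ev p =ᵐ[volume.restrict (interior T.1.closedInterior ∩ Ω)] ev q := by
    filter_upwards [ae_restrict_of_ae_restrict_of_subset inter_subset_right hp.2,
      ae_restrict_of_ae_restrict_of_subset inter_subset_right hq.2,
      ae_restrict_mem hU.measurableSet] with x h1 h2 hx
    rw [← h1 (interior_subset hx.1), ← h2 (interior_subset hx.1)]
  have heq := Measure.eqOn_open_of_ae_eq hae hU (continuous_ev p).continuousOn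
    (continuous_ev q).continuousOn
  rw [← sub_eq_zero]
  exact eq_zero_of_ev_eq_zero_on_open hU hne fun x hx => by rw [ev_sub, heq hx, sub_self]

theorem isRestr_restr (v : Vh 𝒯 k) (T : 𝒯.triangles) : IsRestr k (v : L2 Ω) T.1 (restr v T) :=
  (v.2 T).choose_spec

theorem restr_eq (hΩ : IsOpen Ω) {v : Vh 𝒯 k} {T : 𝒯.triangles} {p : Poly}
    (hp : IsRestr k (v : L2 Ω) T.1 p) : restr v T = p :=
  (isRestr_restr v T).unique hΩ hp

/-- The restrictions to the triangles as a linear map. -/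
def restrLin (hΩ : IsOpen Ω) : Vh 𝒯 k →ₗ[ℝ] (𝒯.triangles → Poly) where
  toFun v T := restr v T
  map_add' v w := funext fun T => restr_eq hΩ ((isRestr_restr v T).add (isRestr_restr w T))
  map_smul' c v := funext fun T => restr_eq hΩ ((isRestr_restr v T).smul c)

theorem restr_mem_P (v : Vh 𝒯 k) (T : 𝒯.triangles) : restr v T ∈ P k := (isRestr_restr v T).1

theorem restr_add (hΩ : IsOpen Ω) (v w : Vh 𝒯 k) (T : 𝒯.triangles) :
    restr (v + w) T = restr v T + restr w T := congrFun (map_add (restrLin hΩ) v w) T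

theorem restr_sub (hΩ : IsOpen Ω) (v w : Vh 𝒯 k) (T : 𝒯.triangles) :
    restr (v - w) T = restr v T - restr w T := congrFun (map_sub (restrLin hΩ) v w) T

theorem eq_zero_of_restr_eq_zero (hΩ : IsOpen Ω) {v : Vh 𝒯 k} (h : ∀ T, restr v T = 0) :
    v = 0 := by
  apply Subtype.ext
  apply (Lp.eq_zero_iff_ae_eq_zero).2
  have hall : ∀ᵐ x ∂(volume.restrict Ω), ∀ T : 𝒯.triangles,
      x ∈ T.1.closedInterior → (v : L2 Ω) x = ev (restr v T) x :=
    ae_all_iff.2 fun T => (isRestr_restr v T).2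
  filter_upwards [hall, ae_restrict_mem hΩ.measurableSet] with x hx hxΩ
  have hcov : x ∈ ⋃ T ∈ 𝒯.triangles, T.closedInterior := by
    rw [𝒯.cover]; exact subset_closure hxΩ
  obtain ⟨T, hT, hxT⟩ := mem_iUnion₂.1 hcov
  rw [hx ⟨T, hT⟩ hxT, h, ev_zero]
  rfl

instance finiteDimensional_Vh [hΩ : Fact (IsOpen Ω)] : FiniteDimensional ℝ (Vh 𝒯 k) := by
  let L : Vh 𝒯 k →ₗ[ℝ] (𝒯.triangles → P k) := LinearMap.pi fun T =>
    ((LinearMap.proj T).comp (restrLin hΩ.out)).codRestrict (P k) fun v => restr_mem_P v T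
  refine FiniteDimensional.of_injective L ?_
  rw [injective_iff_map_eq_zero]
  intro v hv
  exact eq_zero_of_restr_eq_zero hΩ.out fun T => congrArg Subtype.val (congrFun hv T)

/-- Polynomials on the triangles can be prescribed arbitrarily. -/
theorem exists_restr_eq (hΩ : IsOpen Ω) (hb : Bornology.IsBounded Ω) (p : 𝒯.triangles → Poly)
    (hp : ∀ T, p T ∈ P k) : ∃ v : Vh 𝒯 k, ∀ T, restr v T = p T := by
  have : IsFiniteMeasure (volume.restrict Ω) :=
    ⟨by rw [Measure.restrict_apply_univ]; exact hb.measure_lt_top⟩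
  -- Interiors are used because they are pairwise disjoint, so that at most one summand is nonzero
  -- at a point.
  have hmem : ∀ T : 𝒯.triangles, MemLp ((interior T.1.closedInterior).indicator (ev (p T))) 2
      (volume.restrict Ω) := by
    intro T
    refine MemLp.indicator isOpen_interior.measurableSet ?_
    obtain ⟨C, hC⟩ := hb.isCompact_closure.exists_bound_of_continuousOn
      (continuous_ev (p T)).continuousOn
    exact MemLp.of_bound (continuous_ev (p T)).aestronglyMeasurable C
      (ae_restrict_of_forall_mem hΩ.measurableSet fun x hx => hC x (subset_closure hx))
  have hsum := memLp_finsetSum (Finset.univ : Finset 𝒯.triangles) fun T _ => hmem T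
  have hr : ∀ T : 𝒯.triangles, IsRestr k (hsum.toLp _ : L2 Ω) T.1 (p T) := by
    intro T
    refine ⟨hp T, ?_⟩
    -- What the interiors miss is negligible: the frontier of a convex set is null.
    have hfr : ∀ᵐ x ∂(volume.restrict Ω), ∀ S : 𝒯.triangles,
        x ∉ frontier S.1.closedInterior :=
      ae_all_iff.2 fun S => ae_restrict_of_ae (measure_eq_zero_iff_ae_notMem.1
        ((convex_closedInterior S.1).addHaar_frontier volume))
    filter_upwards [hsum.coeFn_toLp, hfr] with x hx hxf hxT
    have hint : ∀ S : 𝒯.triangles, x ∈ S.1.closedInterior → x ∈ interior S.1.closedInterior := by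
      intro S hS
      by_contra hn
      exact hxf S ⟨subset_closure hS, hn⟩
    rw [hx, Finset.sum_eq_single T, indicator_of_mem (hint T hxT)]
    · intro S _ hS
      refine indicator_of_notMem (fun hxS => ?_) _
      exact disjoint_left.1 (𝒯.disjoint_interior S.1 S.2 T.1 T.2 fun h => hS (Subtype.ext h))
        hxS (hint T hxT)
    · simp
  exact ⟨⟨hsum.toLp _, fun T => ⟨p T, hr T⟩⟩, fun T => restr_eq hΩ (hr T)⟩

end Restriction

/-! ### The weak gradient, the seminorm and its kernel. -/

section WeakGradient

variable {Ω : Set Plane} {𝒯 : Triangulation Ω} {k : ℕ}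

open Classical in
/-- The averages on the edges of `T` as a linear map. -/
def avgLin (hΩ : IsOpen Ω) (T : 𝒯.triangles) : Vh 𝒯 k →ₗ[ℝ] (Fin 3 → Poly) where
  toFun v m := avg v T m
  map_add' v w := by
    ext1 m
    simp only [avg, Pi.add_apply, restr_add hΩ]
    split_ifs
    · rfl
    · rw [← smul_add, ← Finset.sum_add_distrib]
      congr 1
      refine Finset.sum_congr rfl fun S _ => ?_
      split_ifs <;> simp
  map_smul' c v := by
    have hs : ∀ S, restr (c • v) S = c • restr v S := congrFun (map_smul (restrLin hΩ) c v)
    ext1 m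
    simp only [avg, Pi.smul_apply, RingHom.id_apply, hs]
    split_ifs
    · rfl
    · rw [smul_comm c, Finset.smul_sum (r := c)]
      congr 1
      refine Finset.sum_congr rfl fun S _ => ?_
      split_ifs <;> simp

theorem avg_mem_P (v : Vh 𝒯 k) (T : 𝒯.triangles) (m : Fin 3) : avg v T m ∈ P k := by
  unfold avg
  split_ifs
  · exact restr_mem_P v T
  · refine Submodule.smul_mem _ _ (Submodule.sum_mem _ fun S _ => ?_)
    split_ifs
    · exact restr_mem_P v S
    · exact Submodule.zero_mem _

/-- The restriction to `T` and the averages on the edges of `T`. -/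
def localData (hΩ : IsOpen Ω) (T : 𝒯.triangles) : Vh 𝒯 k →ₗ[ℝ] Poly × (Fin 3 → Poly) :=
  ((LinearMap.proj (R := ℝ) (φ := fun _ : 𝒯.triangles => Poly) T).comp (restrLin hΩ)).prod (avgLin hΩ T)

theorem isWeakGradient_iff (hΩ : IsOpen Ω) (v : Vh 𝒯 k) (T : 𝒯.triangles) (g : VPoly) :
    IsWeakGradient v T g ↔
      g ∈ RT k ∧ ∀ τ ∈ RT k, innerT T g τ = weakRhs T.1 (localData hΩ T v) τ := by
  have h : ∀ τ, weakRhs T.1 (localData hΩ T v) τ = _ := weakRhs_apply T.1 (restr v T) (avg v T)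
  simp only [IsWeakGradient, h]

theorem existsUnique_isWeakGradient (hΩ : IsOpen Ω) (v : Vh 𝒯 k) (T : 𝒯.triangles) :
    ∃! g : VPoly, IsWeakGradient v T g := by
  simp only [isWeakGradient_iff hΩ]
  obtain ⟨g, hg, h⟩ := exists_innerT_eq T.1 k (weakRhs T.1 (localData hΩ T v))
  exact ⟨g, ⟨hg, h⟩, fun g' hg' => eq_of_forall_innerT_eq T.1 hg'.1 hg fun τ hτ => by
    rw [hg'.2 τ hτ, h τ hτ]⟩

theorem isWeakGradient_weakGrad (hΩ : IsOpen Ω) (v : Vh 𝒯 k) (T : 𝒯.triangles) :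
    IsWeakGradient v T (weakGrad v T) := by
  have h := (existsUnique_isWeakGradient hΩ v T).exists
  rw [weakGrad, dif_pos h]
  exact h.choose_spec

/-- The weak gradient on `T` as a linear map. -/
def weakGradLin (hΩ : IsOpen Ω) (T : 𝒯.triangles) : Vh 𝒯 k →ₗ[ℝ] VPoly where
  toFun v := weakGrad v T
  map_add' v w := by
    refine (existsUnique_isWeakGradient hΩ (v + w) T).unique (isWeakGradient_weakGrad hΩ _ T) ?_
    have hv := (isWeakGradient_iff hΩ v T _).1 (isWeakGradient_weakGrad hΩ v T)
    have hw := (isWeakGradient_iff hΩ w T _).1 (isWeakGradient_weakGrad hΩ w T)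
    refine (isWeakGradient_iff hΩ _ T _).2 ⟨Submodule.add_mem _ hv.1 hw.1, fun τ hτ => ?_⟩
    rw [map_add, map_add, LinearMap.add_apply, ← hv.2 τ hτ, ← hw.2 τ hτ]
    simp only [← innerForm_apply, map_add, LinearMap.add_apply]
  map_smul' c v := by
    refine (existsUnique_isWeakGradient hΩ (c • v) T).unique (isWeakGradient_weakGrad hΩ _ T) ?_
    have hv := (isWeakGradient_iff hΩ v T _).1 (isWeakGradient_weakGrad hΩ v T)
    refine (isWeakGradient_iff hΩ _ T _).2 ⟨Submodule.smul_mem _ c hv.1, fun τ hτ => ?_⟩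
    rw [map_smul, map_smul, LinearMap.smul_apply, ← hv.2 τ hτ]
    simp only [← innerForm_apply, map_smul, LinearMap.smul_apply, RingHom.id_apply]

/-- The weak form as a bilinear form. -/
def weakBilin (hΩ : IsOpen Ω) : LinearMap.BilinForm ℝ (Vh 𝒯 k) :=
  ∑ T : 𝒯.triangles, (innerForm T.1).compl₁₂ (weakGradLin hΩ T) (weakGradLin hΩ T)

theorem weakBilin_apply (hΩ : IsOpen Ω) (u v : Vh 𝒯 k) :
    weakBilin hΩ u v = weakForm u v := by
  simp only [weakBilin, LinearMap.coe_sum, Finset.sum_apply, LinearMap.compl₁₂_apply]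
  rfl

theorem weakForm_comm (u v : Vh 𝒯 k) : weakForm u v = weakForm v u := by
  simp only [weakForm, innerT_comm]

theorem weakForm_self_nonneg (v : Vh 𝒯 k) : 0 ≤ weakForm v v :=
  Finset.sum_nonneg fun T _ => innerT_self_nonneg T.1 _

/-- The triple-bar seminorm. -/
def tripleSeminorm (hΩ : IsOpen Ω) : Seminorm ℝ (Vh 𝒯 k) :=
  Seminorm.of tripleNorm
    (fun v w => by
      -- Cauchy–Schwarz for a semidefinite form, from which the triangle inequality follows as
      -- usual.
      have hcs := (weakBilin hΩ).apply_mul_apply_le_of_forall_zero_le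
        (fun x : Vh 𝒯 k => by rw [weakBilin_apply]; exact weakForm_self_nonneg x) v w
      have hexp : weakForm (v + w) (v + w) =
          weakForm v v + 2 * weakForm v w + weakForm w w := by
        simp only [← weakBilin_apply hΩ, map_add, LinearMap.add_apply]
        rw [weakBilin_apply hΩ w v, weakForm_comm, ← weakBilin_apply hΩ]
        ring
      simp only [weakBilin_apply] at hcs
      rw [weakForm_comm w v] at hcs
      have hv := weakForm_self_nonneg v
      have hw := weakForm_self_nonneg w
      have hle : weakForm v w ≤ Real.sqrt (weakForm v v) * Real.sqrt (weakForm w w) := by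
        rw [← Real.sqrt_mul hv]
        exact Real.le_sqrt_of_sq_le (by rw [sq]; exact hcs)
      unfold tripleNorm
      rw [Real.sqrt_le_left (by positivity), hexp, add_sq, Real.sq_sqrt hv, Real.sq_sqrt hw]
      linarith)
    (fun c v => by
      unfold tripleNorm
      rw [← weakBilin_apply hΩ, map_smul, map_smul, LinearMap.smul_apply, weakBilin_apply,
        smul_eq_mul, smul_eq_mul, ← mul_assoc, Real.sqrt_mul (mul_self_nonneg c),
        Real.sqrt_mul_self_eq_abs, Real.norm_eq_abs])

/-- Definiteness on V_h^0, needed for the norm property and for both halves of well-posedness: the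
local argument makes v piecewise constant, the global one makes the constants zero. -/
theorem eq_zero_of_weakForm_self (hΩ : IsOpen Ω) (hk : 1 ≤ k) {v : Vh 𝒯 k} (hv : v ∈ Vh0 𝒯 k)
    (h : weakForm v v = 0) : v = 0 := by
  have hg : ∀ T : 𝒯.triangles, weakGrad v T = 0 := fun T =>
    eq_zero_of_innerT_self T.1 ((Finset.sum_eq_zero_iff_of_nonneg fun (T : 𝒯.triangles) _ =>
      innerT_self_nonneg T.1 (weakGrad v T)).1 h T (Finset.mem_univ T))
  have hloc : ∀ T : 𝒯.triangles, grad (restr v T) = 0 ∧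
      ∀ m, ∀ x ∈ edge T.1 m, ev (restr v T - avg v T m) x = 0 := by
    intro T
    refine grad_eq_zero_of_forall_innerT_eq T.1 hk (restr_mem_P v T)
      (fun m => Submodule.sub_mem _ (restr_mem_P v T) (avg_mem_P v T m)) fun τ hτ => ?_
    have hw := ((isWeakGradient_iff hΩ v T _).1 (isWeakGradient_weakGrad hΩ v T)).2 τ hτ
    have h0 : innerT T.1 0 τ = 0 := by simp [innerT]
    have he : weakRhs T.1 (localData hΩ T v) τ = _ := weakRhs_eq T.1 (restr v T) (avg v T) τ
    rw [hg T, h0, he] at hw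
    linarith
  -- The restrictions are constants, so their edge conditions need testing at one endpoint only.
  have hA : ∀ (T : 𝒯.triangles) (m : Fin 3), edgeA T.1 m ∈ edge T.1 m := fun T m =>
    left_mem_segment ℝ _ _
  choose c hc using fun T : 𝒯.triangles => (⟨_, eq_C_of_grad_eq_zero (hloc T).1 0⟩ :
    ∃ c : ℝ, restr v T = MvPolynomial.C c)
  have hc0 : c = 0 := by
    classical
    refine eq_zero_of_eq_average 𝒯 c (fun T m hm => ?_) fun T m hm => ?_
    · obtain ⟨p, hp, hp0⟩ := hv T
      have h1 := hp0 m hm _ (hA T m)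
      rwa [← restr_eq hΩ hp, hc, ev_C] at h1
    · have h1 := (hloc T).2 m _ (hA T m)
      rw [ev_sub, sub_eq_zero, avg, if_neg hm, ev_smul, ev_sum, hc, ev_C] at h1
      rw [h1]
      congr 1
      refine Finset.sum_congr rfl fun S _ => ?_
      split_ifs
      · rw [hc, ev_C]
      · rw [ev_zero]
  exact eq_zero_of_restr_eq_zero hΩ fun T => by rw [hc, hc0]; simp

end WeakGradient

/-! ### Lifting of edge data into a triangle. -/

section Interpolation

theorem pow_mem_P {q : Poly} (hq : q ∈ P 1) (n : ℕ) : q ^ n ∈ P n := by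
  rw [MvPolynomial.mem_restrictTotalDegree] at hq ⊢
  exact (MvPolynomial.totalDegree_pow q n).trans (by nlinarith)

theorem aeval_mem_P {q : Poly} (hq : q ∈ P 1) (r : Polynomial ℝ) :
    Polynomial.aeval q r ∈ P r.natDegree := by
  rw [Polynomial.aeval_eq_sum_range]
  refine Submodule.sum_mem _ fun i hi => Submodule.smul_mem _ _ (P_mono ?_ (pow_mem_P hq i))
  exact Nat.lt_succ_iff.1 (Finset.mem_range.1 hi)

theorem ev_aeval (q : Poly) (r : Polynomial ℝ) (x : Plane) :
    ev (Polynomial.aeval q r) x = r.eval (ev q x) := by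
  rw [Polynomial.aeval_eq_sum_range, Polynomial.eval_eq_sum_range]
  simp [ev]

open Polynomial in
/-- A polynomial on `[0, 1]` is its linear interpolant plus a multiple of `t (1 - t)`. -/
theorem exists_eq_linear_add_bubble {k : ℕ} {f : ℝ[X]} (hf : f.natDegree ≤ k) (hk : 1 ≤ k) :
    ∃ r : ℝ[X], (r = 0 ∨ r.natDegree + 2 ≤ k) ∧
      ∀ t, f.eval t = (1 - t) * f.eval 0 + t * f.eval 1 + t * (1 - t) * r.eval t := by
  -- Without its linear interpolant, f has roots 0 and 1 and is t (t - 1) times some r; the bubble t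
  -- (1 - t) accounts for the sign in -r below.
  set g : ℝ[X] := f - (C (f.eval 0) + C (f.eval 1 - f.eval 0) * X) with hg
  have hgdeg : g.natDegree ≤ k := by
    refine (natDegree_sub_le _ _).trans (max_le hf ?_)
    rw [add_comm]
    exact natDegree_linear_le.trans hk
  have hg0 : g.IsRoot 0 := by simp [hg, IsRoot.def]
  have hg1 : g.IsRoot 1 := by simp [hg, IsRoot.def]
  obtain ⟨s, hs⟩ := dvd_iff_isRoot.2 hg0
  have hs1 : s.IsRoot 1 := by
    have h := hg1
    rw [IsRoot.def, hs] at h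
    simpa using h
  obtain ⟨r, hr⟩ := dvd_iff_isRoot.2 hs1
  refine ⟨-r, ?_, fun t => ?_⟩
  -- The zero polynomial has `natDegree` 0, so for k = 1 the degree bound fails and this case must
  -- stand apart.
  · by_cases h0 : r = 0
    · left; rw [h0, neg_zero]
    · right
      have h := hgdeg
      rw [hs, hr, natDegree_mul (X_sub_C_ne_zero _) (mul_ne_zero (X_sub_C_ne_zero _) h0),
        natDegree_mul (X_sub_C_ne_zero _) h0, natDegree_X_sub_C, natDegree_X_sub_C] at h
      rw [natDegree_neg]
      omega
  · have h := congrArg (eval t) (hs.trans (by rw [hr]))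
    simp only [hg, eval_sub, eval_add, eval_mul, eval_C, eval_X] at h
    rw [eval_neg]
    linear_combination h

/-- Polynomials on the three edges of a triangle that match at the vertices are traces of a
polynomial of the same degree. -/
theorem exists_poly_eq_on_edges (T : Affine.Triangle ℝ Plane) {k : ℕ} (hk : 1 ≤ k)
    {f : Fin 3 → Polynomial ℝ} (hf : ∀ m, (f m).natDegree ≤ k) {a : Fin 3 → ℝ}
    (h0 : ∀ m, (f m).eval 0 = a (m + 1)) (h1 : ∀ m, (f m).eval 1 = a (m + 2)) :
    ∃ p ∈ P k, ∀ m t, ev p (AffineMap.lineMap (edgeA T m) (edgeB T m) t) = (f m).eval t := by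
  choose r hr hfr using fun m => exists_eq_linear_add_bubble (hf m) hk
  -- Vertex values plus one bubble per edge. On edge m one has λ_m = 0, λ_{m+1} = 1 - t, λ_{m+2} =
  -- t, so its own bubble becomes t (1 - t) r_m(t), while the other two contain λ_m and vanish.
  refine ⟨∑ m, (MvPolynomial.C (a m) * bary T m +
    bary T (m + 2) * bary T (m + 1) * Polynomial.aeval (bary T (m + 2)) (r m)), ?_, fun m t => ?_⟩
  · refine Submodule.sum_mem _ fun m _ => Submodule.add_mem _
      (C_mul_mem_P _ (P_mono hk (bary_mem_P T m))) ?_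
    rcases hr m with h | h
    · rw [h, map_zero, mul_zero]
      exact Submodule.zero_mem _
    · refine P_mono ?_ (mul_mem_P (mul_mem_P (bary_mem_P T (m + 2)) (bary_mem_P T (m + 1)))
        (aeval_mem_P (bary_mem_P T (m + 2)) (r m)))
      omega
  · set x : Plane := AffineMap.lineMap (edgeA T m) (edgeB T m) t with hx
    have e : ∀ j, ev (bary T j) x =
        (1 - t) * ev (bary T j) (T.points (m + 1)) + t * ev (bary T j) (T.points (m + 2)) :=
      fun j => ev_bary_lineMap T j _ _ t
    have e0 : ev (bary T m) x = 0 := by rw [e]; simp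
    have e1 : ev (bary T (m + 1)) x = 1 - t := by
      rw [e, ev_bary_self, ← add_one_add_one, ev_bary_add_one]; ring
    have e2 : ev (bary T (m + 2)) x = t := by
      rw [e, ev_bary_self, ← add_two_add_two, ev_bary_add_two]; ring
    rw [ev_sum, sum_fin_three m]
    simp only [ev_add, ev_mul, ev_C, ev_aeval, add_one_add_one, add_one_add_two, add_two_add_one,
      add_two_add_two, e0, e1, e2]
    rw [hfr m t, h0, h1]
    ring

theorem edgeInterp_natDegree_le (k : ℕ) (hk : 1 ≤ k) (g : Plane → ℝ)
    (T : Affine.Triangle ℝ Plane) (m : Fin 3) : (edgeInterp k g T m).natDegree ≤ k := by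
  have hk0 : (k : ℝ) ≠ 0 := by exact_mod_cast (by omega : k ≠ 0)
  have h := Lagrange.degree_interpolate_lt (s := Finset.range (k + 1))
    (v := fun j : ℕ => (j : ℝ) / (k : ℝ))
    (fun j : ℕ => g (AffineMap.lineMap (edgeA T m) (edgeB T m) ((j : ℝ) / (k : ℝ))))
    (fun i _ j _ hij => by
      have := (div_left_inj' hk0).1 hij
      exact_mod_cast this)
  rw [Finset.card_range] at h
  exact Polynomial.natDegree_le_iff_coeff_eq_zero.2 fun N hN =>
    (Polynomial.degree_lt_iff_coeff_zero _ _).1 h N hN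

theorem edgeInterp_eval_node (k : ℕ) (hk : 1 ≤ k) (g : Plane → ℝ)
    (T : Affine.Triangle ℝ Plane) (m : Fin 3) {j : ℕ} (hj : j ≤ k) :
    (edgeInterp k g T m).eval ((j : ℝ) / (k : ℝ)) =
      g (AffineMap.lineMap (edgeA T m) (edgeB T m) ((j : ℝ) / (k : ℝ))) := by
  have hk0 : (k : ℝ) ≠ 0 := by exact_mod_cast (by omega : k ≠ 0)
  exact Lagrange.eval_interpolate_at_node (s := Finset.range (k + 1))
    (v := fun j : ℕ => (j : ℝ) / (k : ℝ))
    (fun j : ℕ => g (AffineMap.lineMap (edgeA T m) (edgeB T m) ((j : ℝ) / (k : ℝ))))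
    (fun i _ j _ hij => by
      have := (div_left_inj' hk0).1 hij
      exact_mod_cast this) (Finset.mem_range.2 (Nat.lt_succ_iff.2 hj))

/-- The nodes j = 0 and j = k are the endpoints, so the three interpolants match at the vertices,
with values g(x_m). -/
theorem exists_poly_eq_edgeInterp (T : Affine.Triangle ℝ Plane) {k : ℕ} (hk : 1 ≤ k)
    (g : Plane → ℝ) : ∃ p ∈ P k, ∀ m t,
      ev p (AffineMap.lineMap (edgeA T m) (edgeB T m) t) = (edgeInterp k g T m).eval t := by
  have hk0 : (k : ℝ) ≠ 0 := by exact_mod_cast (by omega : k ≠ 0)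
  refine exists_poly_eq_on_edges T hk (fun m => edgeInterp_natDegree_le k hk g T m)
    (a := fun m => g (T.points m)) (fun m => ?_) (fun m => ?_)
  · simpa [edgeA] using edgeInterp_eval_node k hk g T m (Nat.zero_le k)
  · simpa [hk0, edgeB] using edgeInterp_eval_node k hk g T m le_rfl

end Interpolation

/-! ### Well-posedness of the scheme. -/

section WellPosed

variable {Ω : Set Plane} {𝒯 : Triangulation Ω} {k : ℕ}

/-- Functions in V_h may jump across edges, so the lifting is built triangle by triangle,
interpolating g on every edge whether or not it is a boundary edge. -/
theorem exists_eqInterpOnBoundary (hΩ : IsOpen Ω) (hb : Bornology.IsBounded Ω) (hk : 1 ≤ k)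
    (g : Plane → ℝ) : ∃ u : Vh 𝒯 k, EqInterpOnBoundary u g := by
  choose p hp hpe using fun T : 𝒯.triangles => exists_poly_eq_edgeInterp T.1 hk g
  obtain ⟨u, hu⟩ := exists_restr_eq hΩ hb p hp
  exact ⟨u, fun T m _ t _ => by rw [hu, hpe]⟩

theorem mem_Vh0_iff (hΩ : IsOpen Ω) {v : Vh 𝒯 k} : v ∈ Vh0 𝒯 k ↔
    ∀ (T : 𝒯.triangles) (m : Fin 3), IsBoundaryEdge Ω T m →
      ∀ x ∈ edge T.1 m, ev (restr v T) x = 0 := by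
  constructor
  · intro hv T
    obtain ⟨p, hp, hp0⟩ := hv T
    rwa [restr_eq hΩ hp]
  · intro h T
    exact ⟨restr v T, isRestr_restr v T, h T⟩

theorem EqInterpOnBoundary.sub_mem (hΩ : IsOpen Ω) {u u' : Vh 𝒯 k} {g : Plane → ℝ}
    (hu : EqInterpOnBoundary u g) (hu' : EqInterpOnBoundary u' g) : u - u' ∈ Vh0 𝒯 k := by
  rw [mem_Vh0_iff hΩ]
  intro T m hm x hx
  rw [edge, segment_eq_image_lineMap] at hx
  obtain ⟨t, ht, rfl⟩ := hx
  rw [restr_sub hΩ, ev_sub, hu T m hm t ht, hu' T m hm t ht, sub_self]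

theorem EqInterpOnBoundary.add_mem (hΩ : IsOpen Ω) {u w : Vh 𝒯 k} {g : Plane → ℝ}
    (hu : EqInterpOnBoundary u g) (hw : w ∈ Vh0 𝒯 k) : EqInterpOnBoundary (u + w) g := by
  intro T m hm t ht
  rw [restr_add hΩ, ev_add, hu T m hm t ht,
    (mem_Vh0_iff hΩ).1 hw T m hm _ (lineMap_mem_edge T.1 m ht), add_zero]

theorem integral_mul_eq_inner (f v : L2 Ω) : ∫ x in Ω, f x * v x = inner ℝ f v := by
  rw [L2.inner_def]
  congr 1
  ext x
  simp [mul_comm]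

theorem existsUnique_isSolution (hΩ : IsOpen Ω) (hb : Bornology.IsBounded Ω) (hk : 1 ≤ k)
    (f : L2 Ω) (g : Plane → ℝ) : ∃! u : Vh 𝒯 k, IsSolution f g u := by
  have : Fact (IsOpen Ω) := ⟨hΩ⟩
  obtain ⟨u₀, hu₀⟩ := exists_eqInterpOnBoundary (𝒯 := 𝒯) hΩ hb hk g
  -- w corrects the lifting: B(w, v) = (f, v) - B(u₀, v) for v in V_h^0.
  obtain ⟨w, hw⟩ := exists_bilinForm_eq ((weakBilin hΩ).restrict (Vh0 𝒯 k))
    (fun v hv => Subtype.ext (eq_zero_of_weakForm_self hΩ hk v.2 (by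
      rw [← weakBilin_apply hΩ]; exact hv)))
    (((innerₛₗ ℝ f).comp (Vh 𝒯 k).subtype - weakBilin hΩ u₀).comp (Vh0 𝒯 k).subtype)
  refine ⟨u₀ + w, ⟨hu₀.add_mem hΩ w.2, fun v hv => ?_⟩, fun u hu => ?_⟩
  · have h : weakBilin hΩ (w : Vh 𝒯 k) v = inner ℝ f (v : L2 Ω) - weakBilin hΩ u₀ v :=
      hw ⟨v, hv⟩
    rw [← weakBilin_apply hΩ, map_add, LinearMap.add_apply, h, integral_mul_eq_inner]
    ring
  -- Two solutions differ by some d in V_h^0, an admissible test function, and testing with d gives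
  -- B(d, d) = 0.
  · have hsub := hu.1.sub_mem hΩ (hu₀.add_mem hΩ w.2)
    rw [← sub_eq_zero]
    apply eq_zero_of_weakForm_self hΩ hk hsub
    have h : weakBilin hΩ (w : Vh 𝒯 k) (u - (u₀ + w)) =
        inner ℝ f ((u - (u₀ + w) : Vh 𝒯 k) : L2 Ω) - weakBilin hΩ u₀ (u - (u₀ + w)) :=
      hw ⟨_, hsub⟩
    have h' := hu.2 _ hsub
    rw [← weakBilin_apply hΩ, integral_mul_eq_inner] at h'
    rw [← weakBilin_apply hΩ]
    generalize hd : u - (u₀ + (w : Vh 𝒯 k)) = d at h h'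
    have e : weakBilin hΩ d d = weakBilin hΩ u d - weakBilin hΩ u₀ d -
        weakBilin hΩ (w : Vh 𝒯 k) d := by
      conv_lhs => rw [← hd]
      simp only [map_sub, map_add, LinearMap.sub_apply, LinearMap.add_apply, ← hd]
      ring
    rw [e, h, h']
    ring

end WellPosed

end CDG

end

theorem lemma3p1 (Ω : Set CDG.Plane) (hΩ : CDG.IsPolygonalDomain Ω) (𝒯 : CDG.Triangulation Ω)
    (k : ℕ) (hk : 1 ≤ k) :
    (∀ (v : CDG.Vh 𝒯 k) (T : 𝒯.triangles), ∃! g : CDG.VPoly, CDG.IsWeakGradient v T g) ∧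
    (∃ N : Seminorm ℝ (CDG.Vh 𝒯 k), (∀ v, N v = CDG.tripleNorm v) ∧
      ∀ v ∈ CDG.Vh0 𝒯 k, N v = 0 → v = 0) ∧
    (∀ (f : CDG.L2 Ω) (g : CDG.Plane → ℝ), ∃! u : CDG.Vh 𝒯 k, CDG.IsSolution f g u) :=
  ⟨CDG.existsUnique_isWeakGradient hΩ.isOpen,
    ⟨CDG.tripleSeminorm hΩ.isOpen, fun _ => rfl, fun v hv h =>
      CDG.eq_zero_of_weakForm_self hΩ.isOpen hk hv
        ((Real.sqrt_eq_zero (CDG.weakForm_self_nonneg v)).1 h)⟩,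
    CDG.existsUnique_isSolution hΩ.isOpen hΩ.isBounded hk⟩
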